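/- Let $n\ge 1$ and let $m_1,\dots,m_{n-1}$ be integers that are all positive or all negative. Let $L$ be the diagram of the closure of the braid word $\sigma_1^{m_1}\sigma_2^{m_2}\cdots\sigma_{n-1}^{m_{n-1}}$ on $n$ strands, drawn from top to bottom with all strands oriented downwards and closed up on the right, where $\sigma_i$ is a positive crossing of the strands in positions $i$ and $i+1$ (for $n=1$ it is the crossingless unknot). *Notation.* Let $\langle L\rangle=\sum_s A^{a(s)-b(s)}(-A^2-A^{-2})^{|s|-1}\in\mathbb Z[A^{\pm1}]$ be the Kauffman bracket, where $s$ runs over the choices of an $A$- or $B$-smoothing at every crossing, $a(s)$ and $b(s)$ count these, and $|s|$ is the number of resulting closed curves; at a positive crossing the $A$-smoothing is the one that respects the orientation. Let $wr(L)$ be the writhe and $J(L)=(-A^{-3})^{wr(L)}\langle L\rangle$ the Jones polynomial. Colour the faces of $L$ in checkerboard fashion with the outside face unshaded, and call a crossing checkerboard-positive if its $A$-smoothing merges its two shaded corners, and checkerboard-negative otherwise. Order the crossings, and omit one shaded and one unshaded face that touch along a strand. The balanced overlaid Tait graph $G$ is the bipartite graph whose vertices are the crossings and the remaining faces, a crossing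 being adjacent to the faces it touches. An edge at a shaded face $f$ has the letter $L$ if its crossing is the lowest ordered crossing that touches $f$, and $D$ otherwise; an edge at an unshaded face has $\ell$ or $d$ in the same way; letters at checkerboard-negative crossings get a bar. The weight $\mu(e)$ of an edge is $-A^{-3}$ for $L,\overline\ell$; $-A^{3}$ for $\ell,\overline L$; $A$ for $D,\overline d$; $A^{-1}$ for $d,\overline D$. *Theorem.* The ordering and the two omitted faces can be chosen such that $L$ admits a dimer model, that is $$\sum_{P}\prod_{e\in P}\mu(e)=\langle L\rangle ,$$ where $P$ runs over the perfect matchings of $G$, and such that moreover the following determinant formula holds. Let $M$ be the matrix with rows indexed by the crossings and columns by the remaining faces, whose entry at an adjacent pair is the weight of the edge, multiplied by $-1$ if the face lies between the two incoming strands of the crossing (Kauffman's trick for a Kasteleyn weighting), and whose other entries are $0$. Then $M$ is square, and for every identification of its rows with its columns $$J(L)=\pm\,(-A^{-3})^{wr(L)}\det M .$$ -/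

import Mathlib

/-! Closed braid diagrams, cut into horizontal levels, with their faces, Kauffman states,
bracket and Jones polynomials, balanced overlaid Tait graphs and dimer partition functions.

Laurent polynomials in the variable `A` are `LaurentPolynomial ℤ`, with `A ^ j = T j`. -/

noncomputable section

namespace ClosedBraid

open LaurentPolynomial

/-- A word in the generators `σ₁^{±1}, …, σ_k^{±1}` of the braid group on `k + 1` strands.
The letter `(i, 1)` is `σ_{i+1}` (as `Fin k` starts at `0`), the letter `(i, -1)` is its inverse.

The word is drawn from top to bottom with all strands oriented downwards, and the endpoint of every
strand position at the bottom is joined to the one at the top around the right-hand side.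
The letter `(i, 1)` is a positive (right-handed) crossing, so that the closure of
`σ₁ ^ 3` is the right-handed trefoil. -/
abbrev Word (k : ℕ) := List (Fin k × ℤˣ)

variable {k : ℕ}

/-- The word `σ₁^{m₁} σ₂^{m₂} ⋯ σ_k^{m_k}`. -/
def powerWord (m : Fin k → ℤ) : Word k :=
  (List.finRange k).flatMap fun i =>
    List.replicate (m i).natAbs (i, if 0 < m i then 1 else -1)

/-- The crossings of the closed braid diagram: one for each letter. -/
abbrev Crossing (w : Word k) := Fin w.length

/-- The levels of the diagram: the crossing `t` lies between level `t` (`t.castSucc`, above it)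
and level `t + 1` (`t.succ`, below it); the first and last level are joined by the closure. -/
abbrev Level (w : Word k) := Fin (w.length + 1)

/-- The sign of a crossing of the closed braid, for the downward orientation. -/
def sign (w : Word k) (t : Crossing w) : ℤˣ := (w.get t).2

/-- The left one of the two strand positions that meet at a crossing. -/
def leftStrand (w : Word k) (t : Crossing w) : Fin (k + 1) := (w.get t).1.castSucc

/-- The right one of the two strand positions that meet at a crossing. -/
def rightStrand (w : Word k) (t : Crossing w) : Fin (k + 1) := (w.get t).1.succ

/-! ### Bracket and Jones polynomials -/

/-- One step along the curves of the smoothed diagram. The points are the intersections of the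
strand positions with the levels. A state `s` assigns to each crossing the value `1`
(`A`-smoothing) or `-1` (`B`-smoothing). The `A`-smoothing of a positive crossing and the
`B`-smoothing of a negative crossing consist of two vertical arcs, the other two smoothings of
a cap and a cup. -/
inductive StateStep (w : Word k) (s : Crossing w → ℤˣ) :
    Fin (k + 1) × Level w → Fin (k + 1) × Level w → Prop
  | pass (t : Crossing w) (p : Fin (k + 1)) (hl : p ≠ leftStrand w t) (hr : p ≠ rightStrand w t) :
      StateStep w s (p, t.castSucc) (p, t.succ)
  | verticalLeft (t : Crossing w) (h : s t = sign w t) :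
      StateStep w s (leftStrand w t, t.castSucc) (leftStrand w t, t.succ)
  | verticalRight (t : Crossing w) (h : s t = sign w t) :
      StateStep w s (rightStrand w t, t.castSucc) (rightStrand w t, t.succ)
  | above (t : Crossing w) (h : s t ≠ sign w t) :
      StateStep w s (leftStrand w t, t.castSucc) (rightStrand w t, t.castSucc)
  | below (t : Crossing w) (h : s t ≠ sign w t) :
      StateStep w s (leftStrand w t, t.succ) (rightStrand w t, t.succ)
  | close (p : Fin (k + 1)) : StateStep w s (p, 0) (p, Fin.last _)

/-- The number of closed curves of a state. -/
def loopCount (w : Word k) (s : Crossing w → ℤˣ) : ℕ := Nat.card (Quot (StateStep w s))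

/-- The Kauffman bracket `∑ₛ A^{a(s) - b(s)} (-A² - A⁻²)^{|s| - 1}` of the closed braid diagram,
normalized to `1` on the unknot diagram without crossings
(there is at least one curve in every state). -/
def bracket (w : Word k) : LaurentPolynomial ℤ :=
  ∑ s : Crossing w → ℤˣ,
    T (∑ t, (s t : ℤ)) * (-T 2 - T (-2)) ^ (loopCount w s - 1)

/-- The writhe of the closed braid. -/
def writhe (w : Word k) : ℤ := ∑ t : Crossing w, (sign w t : ℤ)

/-- The correction term `(-A⁻³) ^ writhe`. -/
def writheFactor (w : Word k) : LaurentPolynomial ℤ :=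
  (writhe w).negOnePow • T (-3 * writhe w)

/-- The Jones polynomial, in the variable `A`. -/
def jones (w : Word k) : LaurentPolynomial ℤ := writheFactor w * bracket w

/-! ### Faces and checkerboard colouring -/

/-- The columns between the strand positions: column `0` is left of all strands, column `k + 1` is
right of all strands, and the strand position `p` separates `p.castSucc` from `p.succ`. This is the
column of the faces directly above and below a crossing. -/
def midColumn (w : Word k) (t : Crossing w) : Fin (k + 2) := (w.get t).1.castSucc.succ

/-- The column of the face to the left of a crossing. -/
def leftColumn (w : Word k) (t : Crossing w) : Fin (k + 2) := (w.get t).1.castSucc.castSucc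

/-- The column of the face to the right of a crossing. -/
def rightColumn (w : Word k) (t : Crossing w) : Fin (k + 2) := (w.get t).1.succ.succ

/-- A column at some level lies in the same face as this column at the next level unless the
crossing between them is in this column; the closure joins the first and the last level. -/
inductive FaceStep (w : Word k) : Fin (k + 2) × Level w → Fin (k + 2) × Level w → Prop
  | pass (t : Crossing w) (j : Fin (k + 2)) (h : j ≠ midColumn w t) :
      FaceStep w (j, t.castSucc) (j, t.succ)
  | close (j : Fin (k + 2)) : FaceStep w (j, 0) (j, Fin.last _)

/-- The faces of the closed braid diagram, the outside face included. -/
def Face (w : Word k) := Quot (FaceStep w)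

/-- The face that contains a given column at a given level. -/
def face (w : Word k) (j : Fin (k + 2)) (l : Level w) : Face w := Quot.mk _ (j, l)

instance (w : Word k) : Finite (Face w) := inferInstanceAs (Finite (Quot _))

instance (w : Word k) : Fintype (Face w) := Fintype.ofFinite _

/-- The column of a face. -/
def Face.column {w : Word k} (f : Face w) : Fin (k + 2) :=
  Quot.lift Prod.fst (by rintro _ _ (_ | _) <;> rfl) f

/-- The checkerboard colouring in which the outside face (column `0`) is not shaded:
the colour changes across every strand. -/
def Face.Shaded {w : Word k} (f : Face w) : Prop := Odd (f.column : ℕ)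

/-- Two faces touch along a strand of the diagram. -/
def Face.TouchAlongStrand {w : Word k} (f g : Face w) : Prop :=
  ∃ (p : Fin (k + 1)) (l : Level w),
    (f = face w p.castSucc l ∧ g = face w p.succ l) ∨
      (g = face w p.castSucc l ∧ f = face w p.succ l)

/-- The face above a crossing, between its two incoming strands. -/
def upperFace (w : Word k) (t : Crossing w) : Face w := face w (midColumn w t) t.castSucc

/-- The face below a crossing, between its two outgoing strands. -/
def lowerFace (w : Word k) (t : Crossing w) : Face w := face w (midColumn w t) t.succ

/-- The face to the left of a crossing. -/
def leftFace (w : Word k) (t : Crossing w) : Face w := face w (leftColumn w t) t.castSucc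

/-- The face to the right of a crossing. -/
def rightFace (w : Word k) (t : Crossing w) : Face w := face w (rightColumn w t) t.castSucc

/-- A crossing touches a face if the face occurs at one of its four corners. -/
def Touches (w : Word k) (t : Crossing w) (f : Face w) : Prop :=
  f = upperFace w t ∨ f = lowerFace w t ∨ f = leftFace w t ∨ f = rightFace w t

/-- The sign of a crossing with respect to the checkerboard colouring (not the orientation): it is
positive if the `A`-smoothing merges the two shaded corners. At a positive crossing of
the braid the `A`-smoothing merges the upper and the lower corner, at a negative one the
left and the right corner. -/
def CheckerboardPositive (w : Word k) (t : Crossing w) : Prop :=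
  if sign w t = 1 then (upperFace w t).Shaded else (leftFace w t).Shaded

/-! ### Activity letters -/

/-- The activity letters `L, ℓ, D, d` and their barred versions. -/
inductive ActivityLetter
  | L | l | D | d | Lbar | lbar | Dbar | dbar

/-- The activity letter specialization. -/
def ActivityLetter.specialize : ActivityLetter → LaurentPolynomial ℤ
  | L | lbar => -T (-3)
  | l | Lbar => -T 3
  | D | dbar => T 1
  | d | Dbar => T (-1)

/-! ### Balanced overlaid Tait graphs and dimer models -/

/-- The choices in the definition of a balanced overlaid Tait graph with activity letters:
an ordering of the crossings and two omitted faces, a shaded and an unshaded one, that touch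
along a strand. -/
structure BalancedOverlaidTait (w : Word k) where
  /-- The position of each crossing in the chosen ordering. -/
  rank : Crossing w ≃ Fin w.length
  /-- The omitted shaded face. -/
  omittedShaded : Face w
  /-- The omitted unshaded face. -/
  omittedUnshaded : Face w
  shaded : omittedShaded.Shaded
  unshaded : ¬ omittedUnshaded.Shaded
  touch : omittedShaded.TouchAlongStrand omittedUnshaded

namespace BalancedOverlaidTait

variable {w : Word k} (G : BalancedOverlaidTait w)

/-- The remaining faces; together with the crossings they are the vertices of the bipartite graph,
a crossing and a face being adjacent if they touch. -/
def FaceVertex : Type := {f : Face w // f ≠ G.omittedShaded ∧ f ≠ G.omittedUnshaded}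

instance : Finite G.FaceVertex := inferInstanceAs (Finite {_f : Face w // _})

instance : Fintype G.FaceVertex := Fintype.ofFinite _

open Classical in
/-- The edges of the balanced overlaid Tait graph. -/
def edges : Finset (Crossing w × G.FaceVertex) :=
  Finset.univ.filter fun e => Touches w e.1 e.2.1

/-- The crossing `t` is the lowest ordered neighbour of the face `f`. -/
def IsLowest (t : Crossing w) (f : G.FaceVertex) : Prop :=
  Touches w t f.1 ∧ ∀ t' : Crossing w, Touches w t' f.1 → G.rank t ≤ G.rank t'

open Classical in
/-- The activity letter of the edge between the crossing `t` and the face `f`. -/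
def letter (t : Crossing w) (f : G.FaceVertex) : ActivityLetter :=
  if CheckerboardPositive w t then
    if f.1.Shaded then (if G.IsLowest t f then .L else .D)
    else (if G.IsLowest t f then .l else .d)
  else
    if f.1.Shaded then (if G.IsLowest t f then .Lbar else .Dbar)
    else (if G.IsLowest t f then .lbar else .dbar)

/-- The specialized activity letter of an edge. -/
def weight (t : Crossing w) (f : G.FaceVertex) : LaurentPolynomial ℤ :=
  (G.letter t f).specialize

/-- A set of edges is a perfect matching if every vertex is incident to exactly one of them. -/
def IsPerfectMatching (P : Finset (Crossing w × G.FaceVertex)) : Prop :=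
  P ⊆ G.edges ∧ (∀ t : Crossing w, ∃! e, e ∈ P ∧ e.1 = t) ∧
    ∀ f : G.FaceVertex, ∃! e, e ∈ P ∧ e.2 = f

open Classical in
/-- The sum over all perfect matchings of the product of the weights of their edges. -/
def partitionFunction : LaurentPolynomial ℤ :=
  ∑ P ∈ G.edges.powerset.filter G.IsPerfectMatching, ∏ e ∈ P, G.weight e.1 e.2

/-- The graph is a dimer model of the diagram: its partition function is the bracket. -/
def IsDimerModel : Prop := G.partitionFunction = bracket w

open Classical in
/-- The modified adjacency matrix with rows the crossings, columns the remaining faces, and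
the signs of Kauffman's trick: the edge from a crossing to the face between its two
incoming strands is negative, all other edges are positive. -/
def kauffmanSignedMatrix : Matrix (Crossing w) G.FaceVertex (LaurentPolynomial ℤ) :=
  Matrix.of fun t f =>
    if Touches w t f.1 then
      (if f.1 = upperFace w t then -G.weight t f else G.weight t f)
    else 0

end BalancedOverlaidTait

end ClosedBraid

end

noncomputable section

namespace ClosedBraid

open LaurentPolynomial

variable {k : ℕ}

/-! Write `x = A^ε` and `y = A^(-ε)`, where `ε` is the common sign of all crossings, and `δ = -x² -
y²`. Since the word is sorted by column, both the bracket and the partition function are products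
over the columns, so one column with `n + 1` crossings has to be compared.

State sum: a column with `h ≥ 1` cap-and-cup ("horizontal") smoothings adds `h - 1` curves closed up
inside it; with `h = 0` it disconnects the strands on its two sides and adds one curve
(`loopCount_eq`). Hence the bracket factors (`bracket_eq`). Up to a correction for the state with `h
= 0`, `δ` times a factor is `(x + y δ)^(n+1) = (-y³)^(n+1)` (`loopValue_mul_columnBracket`).

Matchings: omit the outside face and the top face next to it. To each column belong the `n` faces
between its successive crossings and the face to its right. Adjacency becomes block triangular, so a
perfect matching respects the columns. In a column it is determined by the crossing `r` matched with
the right face: the crossings above `r` take their lower faces, those below take their upper faces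
(`exists_blockCycle_eq`). The sum over `r` has the same closed form as the state sum
(`mul_columnSum`, `columnSum_eq_columnBracket`).

Determinant: these matchings are cycles of sign `(-1)^r` in each block, and Kauffman's signs
contribute `(-1)^(n-r)`. The product does not depend on the matching, so the determinant is the
partition function up to a sign (`exists_sum_perm_eq_smul_det`). -/

/-! ### Crossings of the power word, sorted by column. -/

/-- An indexing of the crossings of a word by their column and their position in that column:
the letters of the word are sorted by column, every column occurs, and all signs agree. -/
structure ColumnIndexing (w : Word k) (ε : ℤˣ) where
  /-- The number of crossings of a column, minus one. -/
  extra : Fin k → ℕ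
  /-- The first crossing of a column. -/
  start : Fin k → ℕ
  /-- The crossing at a given position of a column. -/
  index : (Σ j, Fin (extra j + 1)) ≃ Crossing w
  index_val : ∀ j r, (index ⟨j, r⟩ : ℕ) = start j + r
  get_index : ∀ j r, w.get (index ⟨j, r⟩) = (j, ε)
  start_lt : ∀ {i j}, i < j → start i + extra i < start j

theorem sum_castLE_add_le {a : Fin k → ℕ} {i j : Fin k} (h : i < j) :
    (∑ x : Fin i, a (x.castLE i.2.le)) + a i ≤ ∑ x : Fin j, a (x.castLE j.2.le) := by
  have key : ∀ n (hn : n ≤ k), ∑ x : Fin n, a (x.castLE hn) =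
      ∑ x : Fin k with x.1 < n, a x := by
    intro n hn
    refine Finset.sum_bij (fun x _ => x.castLE hn) (by simp) (by simp) ?_ (by simp)
    intro b hb
    exact ⟨⟨b, by simpa using hb⟩, by simp, rfl⟩
  rw [key, key, add_comm, ← Finset.sum_insert (by simp)]
  refine Finset.sum_le_sum_of_subset ?_
  intro x
  simp only [Finset.mem_insert, Finset.mem_filter, Finset.mem_univ, true_and]
  rintro (rfl | hx) <;> omega

theorem getElem?_flatMap_replicate {α : Type*} {k : ℕ} (a : Fin k → ℕ) (g : Fin k → α) (j : Fin k)
    {r : ℕ} (hr : r < a j) :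
    ((List.finRange k).flatMap fun i => List.replicate (a i) (g i))[
      (∑ x : Fin j, a (x.castLE j.2.le)) + r]? = some (g j) := by
  induction k with
  | zero => exact j.elim0
  | succ k ih =>
    rw [List.finRange_succ, List.flatMap_cons, List.flatMap_map]
    refine Fin.cases (fun hr => ?_) (fun j hr => ?_) j hr
    · have h0 : ∑ x : Fin ((0 : Fin (k + 1)) : ℕ), a (x.castLE (0 : Fin (k + 1)).2.le) = 0 :=
        Fin.sum_univ_zero (fun x => a (x.castLE (0 : Fin (k + 1)).2.le))
      rw [h0, zero_add, List.getElem?_append_left (by simpa using hr)]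
      simp [hr]
    · rw [List.getElem?_append_right]
      · have := ih (fun i => a i.succ) (fun i => g i.succ) j hr
        rw [← this]
        congr 1
        have h2 : ∑ x : Fin j.succ, a (x.castLE j.succ.2.le) =
            a 0 + ∑ x : Fin j, a (x.castLE j.2.le).succ :=
          Fin.sum_univ_succ (n := j) (fun x => a (x.castLE j.succ.2.le))
        rw [h2]
        simp only [List.length_replicate]
        omega
      · have h2 : ∑ x : Fin j.succ, a (x.castLE j.succ.2.le) =
            a 0 + ∑ x : Fin j, a (x.castLE j.2.le).succ :=
          Fin.sum_univ_succ (n := j) (fun x => a (x.castLE j.succ.2.le))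
        rw [h2]
        simp only [List.length_replicate]
        omega

theorem length_powerWord (m : Fin k → ℤ) : (powerWord m).length = ∑ i, (m i).natAbs := by
  simp [powerWord, List.length_flatMap, Fin.sum_univ_def]

theorem exists_columnIndexing {m : Fin k → ℤ} (hm : (∀ i, 0 < m i) ∨ (∀ i, m i < 0)) :
    ∃ ε, Nonempty (ColumnIndexing (powerWord m) ε) := by
  obtain ⟨ε, hε⟩ : ∃ ε : ℤˣ, ∀ i, (if 0 < m i then 1 else -1) = ε := by
    rcases hm with h | h
    · exact ⟨1, fun i => if_pos (h i)⟩
    · exact ⟨-1, fun i => if_neg (h i).not_gt⟩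
  -- The truncated subtraction is harmless because no exponent is zero.
  have hpos : ∀ i, (m i).natAbs - 1 + 1 = (m i).natAbs := by
    intro i
    rcases hm with h | h <;> have := h i <;> omega
  have hlen : ∑ i, ((m i).natAbs - 1 + 1) = (powerWord m).length := by
    rw [length_powerWord]
    exact Finset.sum_congr rfl fun i _ => hpos i
  have hval : ∀ j r, ((finSigmaFinEquiv.trans (finCongr hlen) ⟨j, r⟩ :
      Fin (powerWord m).length) : ℕ) =
        ∑ x : Fin j, ((m (x.castLE j.2.le)).natAbs - 1 + 1) + r := by
    intro j r
    simp [finSigmaFinEquiv_apply]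
  refine ⟨ε, ⟨⟨fun j => (m j).natAbs - 1,
    fun j => ∑ x : Fin j, ((m (x.castLE j.2.le)).natAbs - 1 + 1),
    finSigmaFinEquiv.trans (finCongr hlen), hval, fun j r => ?_, fun {i j} h => ?_⟩⟩⟩
  · have := getElem?_flatMap_replicate (fun j => (m j).natAbs - 1 + 1)
      (fun i => (i, if 0 < m i then (1 : ℤˣ) else -1)) j r.2
    have hw : ((List.finRange k).flatMap fun i =>
        List.replicate ((m i).natAbs - 1 + 1) (i, if 0 < m i then (1 : ℤˣ) else -1)) =
          powerWord m := by
      simp only [hpos, powerWord]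
    rw [List.get_eq_getElem, ← Option.some_inj, ← List.getElem?_eq_getElem, hval, ← hw, ← hε j]
    exact this
  · have := sum_castLE_add_le (a := fun j => (m j).natAbs - 1 + 1) h
    omega

namespace ColumnIndexing

variable {w : Word k} {ε : ℤˣ} (c : ColumnIndexing w ε)

theorem sign_eq (c : ColumnIndexing w ε) (t : Crossing w) : sign w t = ε := by
  obtain ⟨⟨j, r⟩, rfl⟩ := c.index.surjective t
  rw [sign, c.get_index]

theorem fst_get_index (j r) : (w.get (c.index ⟨j, r⟩)).1 = j := by
  rw [c.get_index]

theorem monotone_fst_get (c : ColumnIndexing w ε) : Monotone fun t => (w.get t).1 := by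
  intro t t' h
  obtain ⟨⟨j, r⟩, rfl⟩ := c.index.surjective t
  obtain ⟨⟨j', r'⟩, rfl⟩ := c.index.surjective t'
  simp only [c.fst_get_index]
  by_contra! hlt
  have := c.start_lt hlt
  rw [Fin.le_def, c.index_val, c.index_val] at h
  omega

end ColumnIndexing

/-! ### Curves of a state and an invariant labelling of them. -/

/-- The column of a crossing. -/
def crossingColumn (w : Word k) (t : Crossing w) : Fin k := (w.get t).1

/-- A strand position takes part in a crossing. -/
def OnStrand (w : Word k) (t : Crossing w) (p : Fin (k + 1)) : Prop :=
  p = leftStrand w t ∨ p = rightStrand w t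

/-- A state smooths a crossing into a cap and a cup. -/
def Horizontal (w : Word k) (s : Crossing w → ℤˣ) (t : Crossing w) : Prop := s t ≠ sign w t

theorem onStrand_iff {w : Word k} {t : Crossing w} {p : Fin (k + 1)} :
    OnStrand w t p ↔ (p : ℕ) = crossingColumn w t ∨ (p : ℕ) = crossingColumn w t + 1 := by
  simp [OnStrand, leftStrand, rightStrand, crossingColumn, Fin.ext_iff]

/-- The curve of a smoothed diagram that passes through a point. -/
def curve (w : Word k) (s : Crossing w → ℤˣ) (p : Fin (k + 1)) (l : Level w) :
    Quot (StateStep w s) := Quot.mk _ (p, l)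

theorem curve_castSucc_eq_succ {w : Word k} {s : Crossing w → ℤˣ} {t : Crossing w}
    {p : Fin (k + 1)} (h : OnStrand w t p → ¬ Horizontal w s t) :
    curve w s p t.castSucc = curve w s p t.succ := by
  by_cases hp : OnStrand w t p
  · have hv : s t = sign w t := not_not.1 (h hp)
    rcases hp with rfl | rfl
    · exact Quot.sound (.verticalLeft t hv)
    · exact Quot.sound (.verticalRight t hv)
  · rw [OnStrand, not_or] at hp
    exact Quot.sound (.pass t p hp.1 hp.2)

theorem curve_eq_of_le {w : Word k} {s : Crossing w → ℤˣ} {p : Fin (k + 1)} {l l' : Level w}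
    (hl : (l : ℕ) ≤ l')
    (h : ∀ t : Crossing w, (l : ℕ) ≤ t → (t : ℕ) < l' → OnStrand w t p → ¬ Horizontal w s t) :
    curve w s p l = curve w s p l' := by
  induction l' using Fin.induction with
  | zero => rw [show l = 0 from Fin.ext (by simpa using hl)]
  | succ t ih =>
    rcases hl.eq_or_lt with hl | hl
    · rw [Fin.ext hl]
    · rw [Fin.val_succ] at hl
      rw [← curve_castSucc_eq_succ (h t (by omega) (by simp))]
      refine ih (by simpa using Nat.lt_succ_iff.1 hl) fun t' h1 h2 => h t' h1 ?_
      simp at h2 ⊢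
      omega

theorem curve_above {w : Word k} {s : Crossing w → ℤˣ} {t : Crossing w} (h : Horizontal w s t) :
    curve w s (leftStrand w t) t.castSucc = curve w s (rightStrand w t) t.castSucc :=
  Quot.sound (.above t h)

theorem curve_below {w : Word k} {s : Crossing w → ℤˣ} {t : Crossing w} (h : Horizontal w s t) :
    curve w s (leftStrand w t) t.succ = curve w s (rightStrand w t) t.succ :=
  Quot.sound (.below t h)

theorem curve_zero {w : Word k} {s : Crossing w → ℤˣ} (p : Fin (k + 1)) :
    curve w s p 0 = curve w s p (Fin.last _) :=
  Quot.sound (.close p)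

/-- The point `(p, l)` lies on a curve inside a column, whose cap is at the crossing `t`. -/
def Inner (w : Word k) (s : Crossing w → ℤˣ) (p : Fin (k + 1)) (l : Level w) (t : Crossing w) :
    Prop :=
  OnStrand w t p ∧ Horizontal w s t ∧ (l : ℕ) ≤ t ∧
    (∃ t' : Crossing w, (t' : ℕ) < l ∧ crossingColumn w t' = crossingColumn w t ∧
      Horizontal w s t') ∧
    ∀ t' : Crossing w, (l : ℕ) ≤ t' → t' < t → crossingColumn w t' = crossingColumn w t →
      ¬ Horizontal w s t'

/-- Some crossing of a column is smoothed into a cap and a cup. -/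
def Cut (w : Word k) (s : Crossing w → ℤˣ) (j : Fin k) : Prop :=
  ∃ t, crossingColumn w t = j ∧ Horizontal w s t

namespace ColumnIndexing

variable {w : Word k} {ε : ℤˣ}

theorem crossingColumn_index (c : ColumnIndexing w ε) (j r) :
    crossingColumn w (c.index ⟨j, r⟩) = j := c.fst_get_index j r

theorem lt_of_crossingColumn_lt (c : ColumnIndexing w ε) {t t' : Crossing w}
    (h : crossingColumn w t < crossingColumn w t') : t < t' := by
  by_contra! h'
  exact h.not_ge (c.monotone_fst_get h')

theorem crossingColumn_le (c : ColumnIndexing w ε) {t t' : Crossing w} (h : t ≤ t') :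
    crossingColumn w t ≤ crossingColumn w t' := c.monotone_fst_get h

/-- The first crossing of a column. -/
def first (c : ColumnIndexing w ε) (j : Fin k) : Crossing w := c.index ⟨j, 0⟩

theorem crossingColumn_first (c : ColumnIndexing w ε) (j : Fin k) :
    crossingColumn w (c.first j) = j := c.crossingColumn_index j 0

variable {s : Crossing w → ℤˣ}

/-- Columns occupy consecutive ranges of levels, so no level lies below a crossing of one column and
above a crossing of an earlier one. Within a column the cap is the next horizontal crossing. -/
theorem inner_unique (c : ColumnIndexing w ε) {p : Fin (k + 1)} {l : Level w} {t u : Crossing w}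
    (ht : Inner w s p l t) (hu : Inner w s p l u) : t = u := by
  wlog h : crossingColumn w t ≤ crossingColumn w u generalizing t u
  · exact (this hu ht (le_of_not_ge h)).symm
  obtain ⟨-, htH, hlt, -, htmin⟩ := ht
  obtain ⟨-, huH, hlu, ⟨u', hu'l, hu'c, -⟩, humin⟩ := hu
  rcases h.lt_or_eq with h | h
  · rw [← hu'c] at h
    have := c.lt_of_crossingColumn_lt h
    rw [Fin.lt_def] at this
    omega
  · by_contra hne
    rcases lt_or_gt_of_ne hne with h' | h'
    · exact humin t hlt h' h htH
    · exact htmin u hlu h' h.symm huH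

open Classical in
/-- The label of the curve through the top of a strand position. -/
def base (c : ColumnIndexing w ε) (s : Crossing w → ℤˣ) (p : Fin (k + 1)) : Option (Crossing w) :=
  Fin.induction (motive := fun _ => Option (Crossing w)) none
    (fun j b => if Cut w s j then b else some (c.first j)) p

@[simp]
theorem base_zero (c : ColumnIndexing w ε) : c.base s 0 = none := rfl

theorem base_succ_of_cut (c : ColumnIndexing w ε) {j : Fin k} (h : Cut w s j) :
    c.base s j.succ = c.base s j.castSucc := by
  rw [base, Fin.induction_succ, if_pos h]
  rfl

theorem base_succ_of_not_cut (c : ColumnIndexing w ε) {j : Fin k} (h : ¬ Cut w s j) :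
    c.base s j.succ = some (c.first j) := by
  rw [base, Fin.induction_succ, if_neg h]

theorem base_leftStrand (c : ColumnIndexing w ε) {t : Crossing w} (h : Horizontal w s t) :
    c.base s (leftStrand w t) = c.base s (rightStrand w t) :=
  (c.base_succ_of_cut ⟨t, rfl, h⟩).symm

open Classical in
/-- The label of the curve through a point. -/
def label (c : ColumnIndexing w ε) (s : Crossing w → ℤˣ) (p : Fin (k + 1)) (l : Level w) :
    Option (Crossing w) :=
  if h : ∃ t, Inner w s p l t then some h.choose else c.base s p

theorem label_of_inner (c : ColumnIndexing w ε) {p : Fin (k + 1)} {l : Level w} {t : Crossing w}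
    (h : Inner w s p l t) : c.label s p l = some t := by
  have h' : ∃ t, Inner w s p l t := ⟨t, h⟩
  rw [label, dif_pos h', c.inner_unique h'.choose_spec h]

theorem label_of_not_inner (c : ColumnIndexing w ε) {p : Fin (k + 1)} {l : Level w}
    (h : ∀ t, ¬ Inner w s p l t) : c.label s p l = c.base s p := by
  rw [label, dif_neg (by simpa using h)]

theorem label_congr (c : ColumnIndexing w ε) {p p' : Fin (k + 1)} {l l' : Level w}
    (hb : c.base s p = c.base s p') (h : ∀ t, Inner w s p l t ↔ Inner w s p' l' t) :
    c.label s p l = c.label s p' l' := by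
  by_cases hi : ∃ t, Inner w s p l t
  · obtain ⟨t, ht⟩ := hi
    rw [c.label_of_inner ht, c.label_of_inner ((h t).1 ht)]
  · push Not at hi
    rw [c.label_of_not_inner hi, c.label_of_not_inner fun t ht => hi t ((h t).2 ht), hb]

/-- `Inner` sees only horizontal crossings of columns that involve the strand `p`, so moving the
level past any other crossing changes nothing. -/
theorem label_castSucc_eq_succ (c : ColumnIndexing w ε) {t : Crossing w} {p : Fin (k + 1)}
    (h : OnStrand w t p → ¬ Horizontal w s t) :
    c.label s p t.castSucc = c.label s p t.succ := by
  refine c.label_congr rfl fun u => ?_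
  have key : OnStrand w u p → ∀ v, crossingColumn w v = crossingColumn w u →
      Horizontal w s v → (v : ℕ) ≠ t := by
    intro hu v hv hH hvt
    obtain rfl := Fin.ext hvt
    rw [onStrand_iff, ← hv, ← onStrand_iff] at hu
    exact h hu hH
  simp only [Inner, Fin.val_castSucc, Fin.val_succ]
  refine and_congr_right fun hu => and_congr_right fun hH => ?_
  have hne := key hu u rfl hH
  refine and_congr (by omega) (and_congr ?_ ?_)
  · refine exists_congr fun v => and_congr_left fun hv => ?_
    have := key hu v hv.1 hv.2
    omega
  · refine forall_congr' fun v => ?_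
    constructor
    · intro hv h1 h2 h3
      exact hv (by omega) h2 h3
    · intro hv h1 h2 h3 h4
      have := key hu v h3 h4
      exact hv (by omega) h2 h3 h4

/-- The cap belongs to an inner curve exactly if an earlier crossing of its column is horizontal.
Otherwise both ends lie on outer curves, whose labels agree because the column is cut. -/
theorem label_above (c : ColumnIndexing w ε) {t : Crossing w} (h : Horizontal w s t) :
    c.label s (leftStrand w t) t.castSucc = c.label s (rightStrand w t) t.castSucc := by
  by_cases hex : ∃ t' < t, crossingColumn w t' = crossingColumn w t ∧ Horizontal w s t'
  · have hin : ∀ p, OnStrand w t p → Inner w s p t.castSucc t := by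
      intro p hp
      refine ⟨hp, h, le_rfl, ?_, fun v h1 h2 => absurd h2 (not_lt.2 h1)⟩
      simpa using hex
    rw [c.label_of_inner (hin _ (.inl rfl)), c.label_of_inner (hin _ (.inr rfl))]
  · push Not at hex
    have hnot : ∀ p, OnStrand w t p → ∀ u, ¬ Inner w s p t.castSucc u := by
      rintro p - u ⟨-, hH, hle, ⟨v, hv, hvc, hvH⟩, -⟩
      -- The column of `t` is squeezed between those of `v` and `u`, which coincide.
      have h1 := c.crossingColumn_le (t := v) (t' := t) (Fin.le_def.2 (by simp at hv; omega))
      have h2 := c.crossingColumn_le (t := t) (t' := u) (Fin.le_def.2 (by simpa using hle))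
      refine hex v (by simpa using hv) (le_antisymm h1 ?_) hvH
      rwa [hvc]
    rw [c.label_of_not_inner (hnot _ (.inl rfl)), c.label_of_not_inner (hnot _ (.inr rfl)),
      c.base_leftStrand h]

theorem label_below (c : ColumnIndexing w ε) {t : Crossing w} (h : Horizontal w s t) :
    c.label s (leftStrand w t) t.succ = c.label s (rightStrand w t) t.succ := by
  classical
  by_cases hex : ∃ u, t < u ∧ crossingColumn w u = crossingColumn w t ∧ Horizontal w s u
  · obtain ⟨u, ⟨hu, huc, huH⟩, hmin⟩ := WellFounded.has_min (wellFounded_lt (α := Crossing w))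
      {u | t < u ∧ crossingColumn w u = crossingColumn w t ∧ Horizontal w s u} hex
    have hin : ∀ p, OnStrand w t p → Inner w s p t.succ u := by
      intro p hp
      refine ⟨?_, huH, by simpa using hu, ⟨t, by simp, huc.symm, h⟩, fun v h1 h2 h3 h4 => ?_⟩
      · rwa [onStrand_iff, huc, ← onStrand_iff]
      · exact hmin v ⟨by simpa using h1, h3.trans huc, h4⟩ h2
    rw [c.label_of_inner (hin _ (.inl rfl)), c.label_of_inner (hin _ (.inr rfl))]
  · push Not at hex
    have hnot : ∀ p, OnStrand w t p → ∀ u, ¬ Inner w s p t.succ u := by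
      rintro p - u ⟨-, hH, hle, ⟨v, hv, hvc, hvH⟩, -⟩
      have h1 := c.crossingColumn_le (t := v) (t' := t) (Fin.le_def.2 (by simp at hv; omega))
      have h2 := c.crossingColumn_le (t := t) (t' := u) (Fin.le_def.2 (by simp at hle; omega))
      refine hex u (by simpa using hle) (le_antisymm ?_ h2) hH
      rwa [← hvc]
    rw [c.label_of_not_inner (hnot _ (.inl rfl)), c.label_of_not_inner (hnot _ (.inr rfl)),
      c.base_leftStrand h]

theorem not_inner_zero (p : Fin (k + 1)) (t : Crossing w) : ¬ Inner w s p 0 t := by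
  rintro ⟨-, -, -, ⟨v, hv, -⟩, -⟩
  simp at hv

theorem not_inner_last (p : Fin (k + 1)) (t : Crossing w) : ¬ Inner w s p (Fin.last _) t := by
  rintro ⟨-, -, h, -⟩
  have := t.2
  simp at h
  omega

theorem label_step (c : ColumnIndexing w ε) {x y : Fin (k + 1) × Level w}
    (h : StateStep w s x y) : c.label s x.1 x.2 = c.label s y.1 y.2 := by
  cases h with
  | pass t p hl hr =>
    exact c.label_castSucc_eq_succ fun hp => (not_or.2 ⟨hl, hr⟩ hp).elim
  | verticalLeft t h => exact c.label_castSucc_eq_succ fun _ => not_not.2 h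
  | verticalRight t h => exact c.label_castSucc_eq_succ fun _ => not_not.2 h
  | above t h => exact c.label_above h
  | below t h => exact c.label_below h
  | close p =>
    exact (c.label_of_not_inner (not_inner_zero p)).trans
      (c.label_of_not_inner (not_inner_last p)).symm

/-- The label of a curve. -/
def curveLabel (c : ColumnIndexing w ε) (s : Crossing w → ℤˣ) :
    Quot (StateStep w s) → Option (Crossing w) :=
  Quot.lift (fun x => c.label s x.1 x.2) fun _ _ h => c.label_step h

end ColumnIndexing

/-! ### The labels separate the curves, which counts them. -/

namespace ColumnIndexing

variable {w : Word k} {ε : ℤˣ} {s : Crossing w → ℤˣ}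

/-- A curve with a given label. -/
def labelledCurve (s : Crossing w → ℤˣ) : Option (Crossing w) → Quot (StateStep w s)
  | none => curve w s 0 0
  | some t => curve w s (rightStrand w t) t.castSucc

theorem exists_inner {p : Fin (k + 1)} {l : Level w} {t u : Crossing w}
    (hp : OnStrand w u p) (htu : crossingColumn w t = crossingColumn w u)
    (ht : Horizontal w s t) (hu : Horizontal w s u) (htl : (t : ℕ) < l) (hlu : (l : ℕ) ≤ u) :
    ∃ v, Inner w s p l v := by
  obtain ⟨v, ⟨hlv, hvc, hvH⟩, hmin⟩ := WellFounded.has_min (wellFounded_lt (α := Crossing w))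
    {v | (l : ℕ) ≤ v ∧ crossingColumn w v = crossingColumn w u ∧ Horizontal w s v} ⟨u, hlu, rfl, hu⟩
  refine ⟨v, ?_, hvH, hlv, ⟨t, htl, htu.trans hvc.symm, ht⟩, fun x h1 h2 h3 h4 => ?_⟩
  · rwa [onStrand_iff, hvc, ← onStrand_iff]
  · exact hmin x ⟨h1, h3.trans hvc, h4⟩ h2

/-- If horizontal crossings on the strand `p` occur only in the column to its right, the rest of the
strand is one arc, from below the last of them through the closure to above the first. -/
theorem curve_eq_zero {p : Fin (k + 1)} {l : Level w}
    (hp : ∀ t, OnStrand w t p → Horizontal w s t → (crossingColumn w t : ℕ) = p)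
    (hl : ∀ t, ¬ Inner w s p l t) : curve w s p l = curve w s p 0 := by
  by_cases hex : ∃ t : Crossing w, OnStrand w t p ∧ Horizontal w s t ∧ (t : ℕ) < l
  · obtain ⟨t, htp, ht, htl⟩ := hex
    rw [curve_zero]
    refine curve_eq_of_le (Fin.le_last l) fun u hlu _ hup hu => ?_
    obtain ⟨v, hv⟩ := exists_inner hup
      (Fin.ext ((hp t htp ht).trans (hp u hup hu).symm)) ht hu htl hlu
    exact hl v hv
  · push Not at hex
    exact (curve_eq_of_le (Nat.zero_le _) fun t _ htl htp ht =>
      absurd htl (not_lt.2 (hex t htp ht))).symm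

/-- Follow the strand down to the first horizontal crossing of the column; its cap leads to the
strand on the left, again at an outer point. -/
theorem curve_eq_above (c : ColumnIndexing w ε) {j : Fin k} {l : Level w} (hj : Cut w s j)
    (hl : ∀ t : Crossing w, crossingColumn w t = j → Horizontal w s t → (l : ℕ) ≤ t) :
    ∃ l', curve w s j.succ l = curve w s j.castSucc l' ∧ ∀ t, ¬ Inner w s j.castSucc l' t := by
  obtain ⟨t, ⟨rfl, ht⟩, hmin⟩ := WellFounded.has_min (wellFounded_lt (α := Crossing w))
    {t | crossingColumn w t = j ∧ Horizontal w s t} hj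
  refine ⟨t.castSucc, (curve_eq_of_le (l' := t.castSucc) (hl t rfl ht) ?_).trans
    (curve_above ht).symm, ?_⟩
  · intro u _ hut hu huH
    rw [onStrand_iff, Fin.val_succ] at hu
    rcases hu with hu | hu
    · exact absurd (c.lt_of_crossingColumn_lt (t := t) (t' := u) (Fin.lt_def.2 (by omega)))
        (not_lt.2 (Fin.le_def.2 (le_of_lt hut)))
    · exact hmin u ⟨Fin.ext (by omega), huH⟩ hut
  · rintro u ⟨hu, huH, htu, ⟨v, hvt, hvu, hv⟩, -⟩
    have := Fin.le_def.1 (c.crossingColumn_le (t := t) (t' := u) (Fin.le_def.2 htu))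
    rw [onStrand_iff, Fin.val_castSucc] at hu
    exact hmin v ⟨hvu.trans (Fin.ext (by omega)), hv⟩ hvt

/-- Follow the strand up to the last horizontal crossing of the column and cross over along its cup.
`hl'` ensures that no horizontal crossing of the next column is in the way. -/
theorem curve_eq_below (c : ColumnIndexing w ε) {j : Fin k} {l : Level w} (hj : Cut w s j)
    (hl : ∀ t : Crossing w, crossingColumn w t = j → Horizontal w s t → (t : ℕ) < l)
    (hl' : ∀ t : Crossing w, (crossingColumn w t : ℕ) = j + 1 → Horizontal w s t → (l : ℕ) ≤ t) :
    ∃ l', curve w s j.succ l = curve w s j.castSucc l' ∧ ∀ t, ¬ Inner w s j.castSucc l' t := by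
  obtain ⟨t, ⟨rfl, ht⟩, hmax⟩ := WellFounded.has_min (wellFounded_gt (α := Crossing w))
    {t | crossingColumn w t = j ∧ Horizontal w s t} hj
  refine ⟨t.succ, ((curve_eq_of_le (l := t.succ) (l' := l) ?_ ?_).symm.trans
    (curve_below ht).symm), ?_⟩
  · simpa using hl t rfl ht
  · intro u htu hul hu huH
    rw [Fin.val_succ] at htu
    rw [onStrand_iff, Fin.val_succ] at hu
    rcases hu with hu | hu
    · have := hl' u hu.symm huH
      omega
    · exact hmax u ⟨Fin.ext (by omega), huH⟩ (Fin.lt_def.2 htu)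
  · rintro u ⟨hu, huH, htu, -, -⟩
    rw [Fin.val_succ] at htu
    have := Fin.le_def.1 (c.crossingColumn_le (t := t) (t' := u) (Fin.le_def.2 (by omega)))
    rw [onStrand_iff, Fin.val_castSucc] at hu
    exact hmax u ⟨Fin.ext (by omega), huH⟩ (Fin.lt_def.2 htu)

/-- The induction moves one strand to the left across each cut column. An outer point of strand `j +
1` is above the horizontal crossings of column `j`, between those of columns `j` and `j + 1`, or
below both; the last case reduces to the first through the closure. -/
theorem curve_eq_base (c : ColumnIndexing w ε) (p : Fin (k + 1)) {l : Level w}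
    (hl : ∀ t, ¬ Inner w s p l t) : curve w s p l = labelledCurve s (c.base s p) := by
  induction p using Fin.induction generalizing l with
  | zero =>
    refine curve_eq_zero (fun t ht _ => ?_) hl
    rw [onStrand_iff, Fin.val_zero] at ht
    simp
    omega
  | succ j ih =>
    by_cases hj : Cut w s j
    · rw [c.base_succ_of_cut hj]
      suffices ∃ l', curve w s j.succ l = curve w s j.castSucc l' ∧
          ∀ t, ¬ Inner w s j.castSucc l' t by
        obtain ⟨l', h1, h2⟩ := this
        rw [h1, ih h2]
      by_cases h1 : ∀ t : Crossing w, crossingColumn w t = j → Horizontal w s t → (l : ℕ) ≤ t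
      · exact c.curve_eq_above hj h1
      push Not at h1
      obtain ⟨t, rfl, ht, htl⟩ := h1
      have hbelow : ∀ u : Crossing w, crossingColumn w u = crossingColumn w t →
          Horizontal w s u → (u : ℕ) < l := by
        intro u huc hu
        by_contra! hlu
        obtain ⟨v, hv⟩ := exists_inner (p := (crossingColumn w t).succ)
          (onStrand_iff.2 (.inr (by rw [huc]; rfl))) huc.symm ht hu htl hlu
        exact hl v hv
      by_cases h2 : ∀ u : Crossing w, (crossingColumn w u : ℕ) = crossingColumn w t + 1 →
          Horizontal w s u → (l : ℕ) ≤ u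
      · exact c.curve_eq_below hj hbelow h2
      push Not at h2
      obtain ⟨u, huc, hu, hul⟩ := h2
      have h3 : curve w s (crossingColumn w t).succ l = curve w s (crossingColumn w t).succ 0 := by
        rw [curve_zero]
        refine curve_eq_of_le (Fin.le_last l) fun v hlv _ hvp hv => ?_
        have hvp' := hvp
        rw [onStrand_iff, Fin.val_succ] at hvp
        rcases hvp with hvp | hvp
        · obtain ⟨x, hx⟩ := exists_inner hvp' (Fin.ext (by omega)) hu hv hul hlv
          exact hl x hx
        · exact (hbelow v (Fin.ext (by omega)) hv).not_ge hlv
      rw [h3]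
      exact c.curve_eq_above hj fun _ _ _ => Nat.zero_le _
    · rw [c.base_succ_of_not_cut hj]
      have hp : ∀ t, OnStrand w t j.succ → Horizontal w s t →
          (crossingColumn w t : ℕ) = (j.succ : Fin (k + 1)) := by
        intro t htp ht
        rw [onStrand_iff, Fin.val_succ] at htp
        rw [Fin.val_succ]
        refine htp.elim Eq.symm fun h => absurd ⟨t, Fin.ext ?_, ht⟩ hj
        omega
      rw [curve_eq_zero hp hl]
      have hr : rightStrand w (c.first j) = j.succ := by
        have := c.crossingColumn_first j
        rw [crossingColumn] at this
        rw [rightStrand, this]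
      rw [labelledCurve, hr]
      refine curve_eq_of_le (Nat.zero_le _) fun t _ htl htp ht => ?_
      have := hp t htp ht
      rw [Fin.val_succ] at this
      refine absurd (c.lt_of_crossingColumn_lt (t := c.first j) (t' := t) ?_) (not_lt.2 htl.le)
      rw [c.crossingColumn_first, Fin.lt_def]
      omega

theorem curve_eq_labelledCurve (c : ColumnIndexing w ε) (p : Fin (k + 1)) (l : Level w) :
    curve w s p l = labelledCurve s (c.label s p l) := by
  by_cases hi : ∃ t, Inner w s p l t
  · obtain ⟨t, ht⟩ := hi
    rw [c.label_of_inner ht]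
    obtain ⟨htp, htH, hlt, ⟨v, hvl, hvt, hvH⟩, hmin⟩ := ht
    have h1 : curve w s p l = curve w s p t.castSucc := by
      refine curve_eq_of_le hlt fun u hlu hut hup huH => hmin u hlu hut ?_ huH
      refine le_antisymm (c.crossingColumn_le (le_of_lt hut)) ?_
      rw [← hvt]
      exact c.crossingColumn_le (Fin.le_def.2 (by omega))
    rw [h1]
    rcases htp with rfl | rfl
    · exact curve_above htH
    · rfl
  · push Not at hi
    rw [c.label_of_not_inner hi, c.curve_eq_base p hi]

/-- The crossings that label a curve: the cups and caps of a column after the first one, and the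
first crossing of a column that is not cut. -/
def Labels (c : ColumnIndexing w ε) (s : Crossing w → ℤˣ) (t : Crossing w) : Prop :=
  (Horizontal w s t ∧ ∃ t' < t, crossingColumn w t' = crossingColumn w t ∧ Horizontal w s t') ∨
    (t = c.first (crossingColumn w t) ∧ ¬ Cut w s (crossingColumn w t))

theorem labels_of_base (c : ColumnIndexing w ε) {p : Fin (k + 1)} {t : Crossing w}
    (h : c.base s p = some t) : c.Labels s t := by
  induction p using Fin.induction with
  | zero => simp at h
  | succ j ih =>
    by_cases hj : Cut w s j
    · exact ih (by rwa [c.base_succ_of_cut hj] at h)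
    · rw [c.base_succ_of_not_cut hj, Option.some_inj] at h
      subst h
      right
      rw [c.crossingColumn_first]
      exact ⟨rfl, hj⟩

theorem labels_of_label (c : ColumnIndexing w ε) {p : Fin (k + 1)} {l : Level w} {t : Crossing w}
    (h : c.label s p l = some t) : c.Labels s t := by
  by_cases hi : ∃ t, Inner w s p l t
  · obtain ⟨u, hu⟩ := hi
    rw [c.label_of_inner hu, Option.some_inj] at h
    subst h
    obtain ⟨-, hH, hlt, ⟨v, hvl, hvt, hvH⟩, -⟩ := hu
    exact .inl ⟨hH, v, Fin.lt_def.2 (by omega), hvt, hvH⟩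
  · push Not at hi
    rw [c.label_of_not_inner hi] at h
    exact c.labels_of_base h

/-- Right strands serve as representatives in both cases: an inner curve contains its cap, and an
outer curve begins on the right of an uncut column. -/
theorem curveLabel_labelledCurve (c : ColumnIndexing w ε) {t : Crossing w} (h : c.Labels s t) :
    c.curveLabel s (labelledCurve s (some t)) = some t := by
  change c.label s (rightStrand w t) t.castSucc = some t
  rcases h with ⟨hH, hex⟩ | ⟨ht, hcut⟩
  · exact c.label_of_inner ⟨.inr rfl, hH, le_rfl, hex, fun v h1 h2 => absurd h2 (not_lt.2 h1)⟩
  · rw [c.label_of_not_inner]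
    · rw [show rightStrand w t = (crossingColumn w t).succ from rfl,
        c.base_succ_of_not_cut hcut, ← ht]
    · rintro u ⟨hu, huH, htu, ⟨v, hvt, hvu, hv⟩, -⟩
      have h1 := c.crossingColumn_le (t := v) (t' := t) (le_of_lt hvt)
      have h2 := c.crossingColumn_le (t := t) (t' := u) (Fin.le_def.2 htu)
      rw [hvu] at h1
      exact hcut ⟨u, le_antisymm h1 h2, huH⟩

/-- Curves with equal labels coincide by `curve_eq_labelledCurve`. The additional curve, labelled
`none`, passes through the top of the leftmost strand. -/
theorem loopCount_eq (c : ColumnIndexing w ε) (s : Crossing w → ℤˣ) :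
    loopCount w s = {t | c.Labels s t}.ncard + 1 := by
  have hinj : Function.Injective (c.curveLabel s) := by
    rintro ⟨p, l⟩ ⟨p', l'⟩ h
    change c.label s p l = c.label s p' l' at h
    change curve w s p l = curve w s p' l'
    rw [c.curve_eq_labelledCurve, c.curve_eq_labelledCurve, h]
  have hrange : Set.range (c.curveLabel s) = insert none (some '' {t | c.Labels s t}) := by
    ext x
    constructor
    · rintro ⟨⟨p, l⟩, rfl⟩
      change c.label s p l ∈ _
      cases h : c.label s p l with
      | none => simp
      | some t => simpa using c.labels_of_label h
    · rintro (rfl | ⟨t, ht, rfl⟩)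
      · exact ⟨labelledCurve s none, c.label_of_not_inner (not_inner_zero 0)⟩
      · exact ⟨_, c.curveLabel_labelledCurve ht⟩
  rw [loopCount, Nat.card_congr (Equiv.ofInjective _ hinj), hrange, Nat.card_coe_set_eq,
    Set.ncard_insert_of_notMem (by simp), Set.ncard_image_of_injective _ (Option.some_injective _)]

end ColumnIndexing

/-! ### The bracket as a product of column state sums. -/

theorem T_sum {ι : Type*} (S : Finset ι) (f : ι → ℤ) :
    (T (∑ i ∈ S, f i) : LaurentPolynomial ℤ) = ∏ i ∈ S, T (f i) := by
  classical
  induction S using Finset.induction_on with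
  | empty => simp
  | insert a S ha ih => rw [Finset.sum_insert ha, Finset.prod_insert ha, T_add, ih]

/-- The value `-A² - A⁻²` of a closed curve. -/
def loopValue : LaurentPolynomial ℤ := -T 2 - T (-2)

theorem loopValue_eq (ε : ℤˣ) :
    loopValue = -(T (ε : ℤ)) ^ 2 - (T (-(ε : ℤ))) ^ 2 := by
  rcases Int.units_eq_one_or ε with rfl | rfl
  · simp [loopValue, T_pow]
  · simp [loopValue, T_pow]
    ring

theorem loopValue_ne_zero : loopValue ≠ 0 := by
  intro h
  have h2 := congrArg (eval₂ (RingHom.id ℤ) 1) h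
  rw [loopValue, map_sub, map_neg, eval₂_T, eval₂_T, map_zero] at h2
  simp at h2

/-- A crossing labels a curve, in terms of the smoothings `v` in its column. -/
def LabelsColumn {n : ℕ} (ε : ℤˣ) (v : Fin (n + 1) → ℤˣ) (r : Fin (n + 1)) : Prop :=
  (v r ≠ ε ∧ ∃ r' < r, v r' ≠ ε) ∨ (r = 0 ∧ ∀ r', v r' = ε)

theorem ncard_labelsColumn_of_forall {n : ℕ} {ε : ℤˣ} {v : Fin (n + 1) → ℤˣ} (h : ∀ r, v r = ε) :
    {r | LabelsColumn ε v r}.ncard = 1 := by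
  have : {r | LabelsColumn ε v r} = {0} := by
    ext r
    simp [LabelsColumn, h]
  rw [this, Set.ncard_singleton]

/-- The first horizontal crossing is the only one without a label, as its cap lies on an outer
curve. -/
theorem ncard_labelsColumn_add_one {n : ℕ} {ε : ℤˣ} {v : Fin (n + 1) → ℤˣ} (h : ∃ r, v r ≠ ε) :
    {r | LabelsColumn ε v r}.ncard + 1 = {r | v r ≠ ε}.ncard := by
  obtain ⟨r₀, hr₀, hmin⟩ := WellFounded.has_min (wellFounded_lt (α := Fin (n + 1)))
    {r | v r ≠ ε} h
  have : {r | v r ≠ ε} = insert r₀ {r | LabelsColumn ε v r} := by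
    ext r
    simp only [LabelsColumn, Set.mem_ofPred_eq, Set.mem_insert_iff]
    constructor
    · intro hr
      rcases lt_trichotomy r r₀ with h' | h' | h'
      · exact absurd h' (hmin r hr)
      · exact .inl h'
      · exact .inr (.inl ⟨hr, r₀, h', hr₀⟩)
    · rintro (rfl | ⟨hr, -⟩ | ⟨-, hr⟩)
      · exact hr₀
      · exact hr
      · exact absurd (hr r₀) hr₀
  rw [this, Set.ncard_insert_of_notMem]
  rintro (⟨-, r', h1, h2⟩ | ⟨-, h1⟩)
  · exact hmin r' h2 h1
  · exact hr₀ (h1 r₀)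

/-- The state sum of the `n + 1` crossings of one column. -/
def columnBracket (ε : ℤˣ) (n : ℕ) : LaurentPolynomial ℤ :=
  ∑ v : Fin (n + 1) → ℤˣ, (∏ r, T (v r : ℤ)) * loopValue ^ {r | LabelsColumn ε v r}.ncard

/-- After multiplication by `δ`, a state with `h ≥ 1` horizontal crossings carries `δ^h`, a product
over crossings. The all-vertical state carries `δ²` instead of `1`, whence the correction. -/
theorem loopValue_mul_columnBracket (ε : ℤˣ) (n : ℕ) :
    loopValue * columnBracket ε n =
      (-(T (-(ε : ℤ))) ^ 3) ^ (n + 1) + T (ε : ℤ) ^ (n + 1) * (loopValue ^ 2 - 1) := by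
  classical
  have hterm : ∀ v : Fin (n + 1) → ℤˣ,
      loopValue * ((∏ r, T (v r : ℤ)) * loopValue ^ {r | LabelsColumn ε v r}.ncard) =
        (∏ r, (T (v r : ℤ) * if v r = ε then 1 else loopValue)) +
          if v = (fun _ => ε) then T (ε : ℤ) ^ (n + 1) * (loopValue ^ 2 - 1) else 0 := by
    intro v
    rw [Finset.prod_mul_distrib]
    have hprod : ∏ r, (if v r = ε then 1 else loopValue) = loopValue ^ {r | v r ≠ ε}.ncard := by
      rw [Finset.prod_ite, Finset.prod_const_one, one_mul, Finset.prod_const,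
        Set.ncard_eq_toFinset_card']
      congr 2
      ext r
      simp
    rw [hprod]
    by_cases h : ∀ r, v r = ε
    · rw [if_pos (funext h), ncard_labelsColumn_of_forall h]
      obtain rfl : v = fun _ => ε := funext h
      simp
      ring
    · rw [if_neg fun h' => h (congrFun h'), ← ncard_labelsColumn_add_one (not_forall.1 h)]
      ring
  -- One crossing contributes `x + y δ = -y³`, since `x y = 1`.
  have hsum : ∑ u : ℤˣ, ((T (u : ℤ) : LaurentPolynomial ℤ) * if u = ε then 1 else loopValue) =
      -(T (-(ε : ℤ))) ^ 3 := by
    have hT : (T (ε : ℤ) : LaurentPolynomial ℤ) * T (-(ε : ℤ)) = 1 := by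
      rw [← T_add]; simp
    have huniv : (Finset.univ : Finset ℤˣ) = {ε, -ε} := by
      ext u
      rcases Int.units_eq_one_or u with rfl | rfl <;>
        rcases Int.units_eq_one_or ε with rfl | rfl <;> simp
    have hne : -ε ≠ ε := by
      rcases Int.units_eq_one_or ε with rfl | rfl <;> decide
    rw [huniv, Finset.sum_pair hne.symm, if_pos rfl, if_neg hne, loopValue_eq ε, Units.val_neg]
    linear_combination (-T (ε : ℤ)) * hT
  rw [columnBracket, Finset.mul_sum, Finset.sum_congr rfl fun v _ => hterm v,
    Finset.sum_add_distrib, Finset.sum_ite_eq', if_pos (Finset.mem_univ _), ← hsum]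
  congr 1
  rw [← Fin.prod_const, Finset.prod_univ_sum, Fintype.piFinset_univ]

namespace ColumnIndexing

variable {w : Word k} {ε : ℤˣ} {s : Crossing w → ℤˣ}

theorem labels_index (c : ColumnIndexing w ε) (j : Fin k) (r : Fin (c.extra j + 1)) :
    c.Labels s (c.index ⟨j, r⟩) ↔ LabelsColumn ε (fun r => s (c.index ⟨j, r⟩)) r := by
  simp only [Labels, LabelsColumn, Cut, Horizontal, c.sign_eq, crossingColumn_index]
  refine or_congr (and_congr_right fun _ => ?_) (and_congr ?_ ?_)
  · constructor
    · rintro ⟨t, ht, htj, hs⟩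
      obtain ⟨⟨j', r'⟩, rfl⟩ := c.index.surjective t
      rw [crossingColumn_index] at htj
      subst htj
      rw [Fin.lt_def, c.index_val, c.index_val] at ht
      exact ⟨r', Fin.lt_def.2 (by omega), hs⟩
    · rintro ⟨r', hr', hs⟩
      refine ⟨_, ?_, c.crossingColumn_index j r', hs⟩
      rw [Fin.lt_def, c.index_val, c.index_val]
      simpa using hr'
  · simp [first]
  · constructor
    · intro h r'
      by_contra hs
      exact h ⟨_, c.crossingColumn_index j r', hs⟩
    · rintro h ⟨t, htj, hs⟩
      obtain ⟨⟨j', r'⟩, rfl⟩ := c.index.surjective t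
      rw [crossingColumn_index] at htj
      subst htj
      exact hs (h r')

theorem ncard_labels (c : ColumnIndexing w ε) (s : Crossing w → ℤˣ) :
    {t | c.Labels s t}.ncard =
      ∑ j, {r | LabelsColumn ε (fun r => s (c.index ⟨j, r⟩)) r}.ncard := by
  classical
  have h : {t | c.Labels s t} = c.index ''
      ((Finset.univ.sigma fun j => {r | LabelsColumn ε (fun r => s (c.index ⟨j, r⟩)) r} :
        Finset (Σ j, Fin (c.extra j + 1))) : Set (Σ j, Fin (c.extra j + 1))) := by
    ext t
    obtain ⟨⟨j, r⟩, rfl⟩ := c.index.surjective t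
    simp [c.labels_index]
  rw [h, Set.ncard_image_of_injective _ c.index.injective, Set.ncard_coe_finset,
    Finset.card_sigma]
  refine Finset.sum_congr rfl fun j _ => ?_
  rw [Set.ncard_eq_toFinset_card']
  congr 1
  ext r
  simp

theorem bracket_eq (c : ColumnIndexing w ε) :
    bracket w = ∏ j, columnBracket ε (c.extra j) := by
  simp only [columnBracket]
  rw [Finset.prod_univ_sum, Fintype.piFinset_univ, bracket]
  refine Fintype.sum_equiv ((Equiv.arrowCongr c.index.symm (Equiv.refl ℤˣ)).trans
    (Equiv.piCurry fun j _ => ℤˣ)) _ _ fun s => ?_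
  rw [c.loopCount_eq, Nat.add_sub_cancel, ncard_labels, T_sum, ← Finset.prod_pow_eq_pow_sum,
    Finset.prod_mul_distrib, ← c.index.prod_comp, Fintype.prod_sigma]
  rfl

end ColumnIndexing

/-! ### Permutations and determinants with block triangular support. -/

section Permutations

open Equiv

variable {k : ℕ} {n : Fin k → ℕ} {R : Type*} [CommRing R]

/-- Before `τ.symm 0` the values are forced upwards from `0`, since `r` is already taken by `r - 1`.
After it they are forced downwards from `n`, since `r + 1` is already taken. -/
theorem eq_cycleRange {n : ℕ} (τ : Perm (Fin (n + 1)))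
    (h : ∀ r, τ r = 0 ∨ (τ r : ℕ) = r ∨ (τ r : ℕ) = r + 1) :
    τ = Fin.cycleRange (τ.symm 0) := by
  set r₀ := τ.symm 0 with hr₀
  have hz : τ r₀ = 0 := by simp [hr₀]
  have hne : ∀ r, r ≠ r₀ → (τ r : ℕ) = r ∨ (τ r : ℕ) = r + 1 := fun r hr =>
    (h r).resolve_left fun h0 => hr (τ.injective (h0.trans hz.symm))
  have hlt : ∀ m (hm : m < n + 1), m < r₀ → (τ ⟨m, hm⟩ : ℕ) = m + 1 := by
    intro m
    induction m with
    | zero =>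
      intro hm hm'
      have hne0 : (⟨0, hm⟩ : Fin (n + 1)) ≠ r₀ := Fin.ne_of_val_ne hm'.ne
      refine (hne _ hne0).resolve_left fun h0 => hne0 (τ.injective ?_)
      rw [hz]
      exact Fin.ext h0
    | succ m ih =>
      intro hm hm'
      refine (hne _ (Fin.ne_of_val_ne hm'.ne)).resolve_left fun h0 => ?_
      have h1 := ih (by omega) (by omega)
      have := congrArg Fin.val (τ.injective (Fin.ext (h0.trans h1.symm)))
      simp at this
  have hgt : ∀ d m (hm : m < n + 1), m + d = n → (r₀ : ℕ) < m → (τ ⟨m, hm⟩ : ℕ) = m := by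
    intro d
    induction d with
    | zero =>
      intro m hm hd hm'
      have := (τ ⟨m, hm⟩).2
      refine (hne _ (Fin.ne_of_val_ne hm'.ne')).resolve_right fun h0 => ?_
      dsimp only at h0
      omega
    | succ d ih =>
      intro m hm hd hm'
      refine (hne _ (Fin.ne_of_val_ne hm'.ne')).resolve_right fun h0 => ?_
      have h1 := ih (m + 1) (by omega) (by omega) (by omega)
      have := congrArg Fin.val (τ.injective (Fin.ext (h0.trans h1.symm)))
      simp at this
  ext r
  rcases lt_trichotomy r r₀ with hr | rfl | hr
  · rw [Fin.coe_cycleRange_of_lt hr]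
    exact hlt r r.2 hr
  · rw [Fin.cycleRange_self, hz]
  · rw [Fin.cycleRange_of_gt hr]
    exact hgt (n - r) r r.2 (by omega) hr

/-- The support of a block triangular matrix, the diagonal blocks of which are supported in the
first column, the diagonal, and the diagonal above it. -/
def BlockSupport (x y : Σ j, Fin (n j + 1)) : Prop :=
  y.1 < x.1 ∨ (y.1 = x.1 ∧ ((y.2 : ℕ) = 0 ∨ (y.2 : ℕ) = x.2 ∨ (y.2 : ℕ) = x.2 + 1))

theorem BlockSupport.fst_le {x y : Σ j, Fin (n j + 1)} (h : BlockSupport x y) : y.1 ≤ x.1 :=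
  h.elim le_of_lt fun h => h.1.le

/-- The permutations that are a cycle `(0 1 ⋯ r)` in every block. -/
def blockCycle (r : ∀ j, Fin (n j + 1)) : Perm (Σ j, Fin (n j + 1)) :=
  Perm.sigmaCongrRight fun j => Fin.cycleRange (r j)

theorem blockCycle_apply (r : ∀ j, Fin (n j + 1)) (j : Fin k) (q : Fin (n j + 1)) :
    blockCycle r ⟨j, q⟩ = ⟨j, Fin.cycleRange (r j) q⟩ := rfl

theorem blockCycle_injective : Function.Injective (blockCycle (n := n)) := by
  intro r r' h
  funext j
  have h1 := congrArg (fun σ => σ ⟨j, r j⟩) h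
  simp only [blockCycle_apply, Fin.cycleRange_self, Sigma.mk.injEq, heq_eq_eq, true_and] at h1
  rw [← Fin.cycleRange_self (r' j)] at h1
  exact (Fin.cycleRange (r' j)).injective h1.symm

theorem exists_blockCycle_eq (σ : Perm (Σ j, Fin (n j + 1))) (h : ∀ x, BlockSupport x (σ x)) :
    ∃ r, blockCycle r = σ := by
  -- A permutation preserves the sum of the block indices, so an inequality at every point is an
  -- equality at every point.
  have hfst : ∀ x, (σ x).1 = x.1 := by
    have := (Finset.sum_eq_sum_iff_of_le (s := Finset.univ)
      fun x _ => Fin.le_def.1 (h x).fst_le).1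
      (Equiv.sum_comp σ fun x => (x.1 : ℕ))
    exact fun x => Fin.ext (this x (Finset.mem_univ x))
  have hex : ∀ j r, ∃ q, σ ⟨j, r⟩ = ⟨j, q⟩ := by
    intro j r
    have h1 := hfst ⟨j, r⟩
    generalize σ ⟨j, r⟩ = y at h1
    obtain ⟨j', q⟩ := y
    obtain rfl : j' = j := h1
    exact ⟨q, rfl⟩
  choose f hf using hex
  have hinj : ∀ j, Function.Injective (f j) := by
    intro j q q' hq
    have h1 : σ ⟨j, q⟩ = σ ⟨j, q'⟩ := by rw [hf, hf, hq]
    simpa using σ.injective h1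
  let τ : ∀ j, Perm (Fin (n j + 1)) := fun j =>
    Equiv.ofBijective (f j) (Finite.injective_iff_bijective.1 (hinj j))
  refine ⟨fun j => (τ j).symm 0, Equiv.ext fun ⟨j, q⟩ => ?_⟩
  rw [blockCycle_apply, ← eq_cycleRange (τ j), hf]
  · rfl
  · intro q
    have h1 := h ⟨j, q⟩
    rw [hf] at h1
    rcases h1 with h1 | ⟨-, h1⟩
    · exact absurd h1 (lt_irrefl _)
    · exact h1.imp_left Fin.ext

theorem sum_perm_prod {W : (Σ j, Fin (n j + 1)) → (Σ j, Fin (n j + 1)) → R}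
    (hW : ∀ x y, ¬ BlockSupport x y → W x y = 0) (g : Perm (Σ j, Fin (n j + 1)) → R) :
    ∑ σ, g σ * ∏ x, W x (σ x) =
      ∑ r : ∀ j, Fin (n j + 1), g (blockCycle r) * ∏ x, W x (blockCycle r x) := by
  refine (Fintype.sum_of_injective _ blockCycle_injective _ _ (fun σ hσ => ?_) fun r => rfl).symm
  have : ¬ ∀ x, BlockSupport x (σ x) := fun h => hσ (exists_blockCycle_eq σ h)
  push Not at this
  obtain ⟨x, hx⟩ := this
  have h0 : ∏ x, W x (σ x) = 0 := Finset.prod_eq_zero (Finset.mem_univ x) (hW _ _ hx)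
  rw [h0, mul_zero]

theorem sum_perm_prod_eq_prod {W : (Σ j, Fin (n j + 1)) → (Σ j, Fin (n j + 1)) → R}
    (hW : ∀ x y, ¬ BlockSupport x y → W x y = 0) :
    ∑ σ : Perm (Σ j, Fin (n j + 1)), ∏ x, W x (σ x) =
      ∏ j, ∑ r : Fin (n j + 1), ∏ q, W ⟨j, q⟩ ⟨j, Fin.cycleRange r q⟩ := by
  have := sum_perm_prod hW fun _ => 1
  simp only [one_mul] at this
  rw [this, Finset.prod_univ_sum, Fintype.piFinset_univ]
  refine Finset.sum_congr rfl fun r _ => ?_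
  rw [Fintype.prod_sigma]
  rfl

/-- Both sides are homomorphisms on a product of groups, so it suffices to compare them on each
factor. -/
theorem sign_sigmaCongrRight (τ : ∀ j, Perm (Fin (n j + 1))) :
    Perm.sign (Perm.sigmaCongrRight τ) = ∏ j, Perm.sign (τ j) := by
  let f : (∀ j, Perm (Fin (n j + 1))) →* ℤˣ :=
    Perm.sign.comp (Perm.sigmaCongrRightHom fun j => Fin (n j + 1))
  let g : (∀ j, Perm (Fin (n j + 1))) →* ℤˣ :=
    ∏ j, Perm.sign.comp (Pi.evalMonoidHom (fun j => Perm (Fin (n j + 1))) j)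
  suffices f = g by
    have := DFunLike.congr_fun this τ
    simpa [f, g] using this
  refine MonoidHom.pi_ext fun j x => ?_
  have hg : g (Pi.mulSingle j x) = Perm.sign x := by
    simp only [g, MonoidHom.finsetProd_apply, MonoidHom.comp_apply, Pi.evalMonoidHom_apply]
    rw [Finset.prod_eq_single j]
    · rw [Pi.mulSingle_eq_same]
    · intro i _ hi
      rw [Pi.mulSingle_eq_of_ne hi, map_one]
    · simp
  rw [hg]
  symm
  refine Perm.sign_bij (fun q _ => ⟨j, q⟩) ?_ ?_ ?_
  · intro q _ _
    simp
  · intro q q' _ _ h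
    simpa using h
  · rintro ⟨i, q⟩ hq
    by_cases hi : i = j
    · subst hi
      refine ⟨q, fun h => hq ?_, rfl⟩
      simp [h]
    · exact absurd (by simp [Pi.mulSingle_eq_of_ne hi]) hq

theorem sign_blockCycle (r : ∀ j, Fin (n j + 1)) :
    Perm.sign (blockCycle r) = ∏ j, (-1) ^ (r j : ℕ) := by
  simp only [blockCycle, sign_sigmaCongrRight, Fin.sign_cycleRange]

open Classical in
/-- Kauffman's signs: the diagonal entries outside of the first column are negative. -/
def blockSign (x y : Σ j, Fin (n j + 1)) : R := if y = x ∧ (y.2 : ℕ) ≠ 0 then -1 else 1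

/-- A block cycle meets the diagonal outside the first column exactly at the positions after `r j`.
-/
theorem prod_blockSign (r : ∀ j, Fin (n j + 1)) :
    ∏ x, (blockSign x (blockCycle r x) : R) = ∏ j, (-1) ^ (n j - (r j : ℕ)) := by
  rw [Fintype.prod_sigma]
  refine Finset.prod_congr rfl fun j _ => ?_
  have hcard : n j - (r j : ℕ) = (Finset.Ioi (r j)).card := by
    rw [Fin.card_Ioi]
    omega
  rw [hcard, ← Finset.prod_const]
  have : ∀ q, (blockSign ⟨j, q⟩ (blockCycle r ⟨j, q⟩) : R) =
      if q ∈ Finset.Ioi (r j) then -1 else 1 := by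
    intro q
    rw [blockCycle_apply, blockSign]
    refine if_congr (Iff.trans ?_ Finset.mem_Ioi.symm) rfl rfl
    rcases lt_trichotomy q (r j) with h | rfl | h
    · simp only [Sigma.mk.injEq, heq_eq_eq, true_and, Fin.ext_iff, Fin.coe_cycleRange_of_lt h]
      rw [Fin.lt_def] at *
      omega
    · simp
    · rw [Fin.cycleRange_of_gt h]
      simp only [true_and, iff_true_right h]
      rw [Fin.lt_def] at h
      omega
  rw [Finset.prod_congr rfl fun q _ => this q, Finset.prod_ite_mem, Finset.univ_inter]

/-- Signs are prescribed on the diagonal blocks only; entries off them occur in no nonzero product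
over a permutation. -/
theorem exists_sum_perm_eq_smul_det {W : (Σ j, Fin (n j + 1)) → (Σ j, Fin (n j + 1)) → R}
    (hW : ∀ x y, ¬ BlockSupport x y → W x y = 0)
    {M : Matrix (Σ j, Fin (n j + 1)) (Σ j, Fin (n j + 1)) R}
    (hM : ∀ x y, ¬ BlockSupport x y → M x y = 0)
    (hMW : ∀ x y, y.1 = x.1 → M x y = blockSign x y * W x y) :
    ∃ u : ℤˣ, ∑ σ : Perm (Σ j, Fin (n j + 1)), ∏ x, W x (σ x) = u • M.det := by
  refine ⟨∏ j, (-1) ^ n j, ?_⟩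
  rw [← Matrix.det_transpose, Matrix.det_apply']
  simp only [Matrix.transpose_apply]
  have h1 := sum_perm_prod hW fun _ => 1
  simp only [one_mul] at h1
  rw [h1, sum_perm_prod hM fun σ => ((Perm.sign σ : ℤ) : R), Finset.smul_sum]
  refine Finset.sum_congr rfl fun r _ => ?_
  rw [Finset.prod_congr rfl fun x _ => hMW x (blockCycle r x) rfl, Finset.prod_mul_distrib,
    sign_blockCycle, prod_blockSign, Units.smul_def, zsmul_eq_mul, ← mul_assoc, ← mul_assoc]
  convert (one_mul _).symm using 2
  push_cast
  rw [← Finset.prod_mul_distrib, ← Finset.prod_mul_distrib]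
  refine Finset.prod_eq_one fun j _ => ?_
  rw [← pow_add, ← pow_add]
  refine Even.neg_one_pow ⟨n j, ?_⟩
  have := (r j).2
  omega

/-- The partition function of the edges at the `n + 1` crossings of one column, `x` and `y`
being the variable and its inverse, or the other way around. -/
def columnSum (x y : R) (n : ℕ) : R :=
  ∑ r : Fin (n + 1), ∏ q : Fin (n + 1),
    if q < r then -y ^ 3 else if q = r then (if q = 0 then -x ^ 3 else y) else x

theorem columnSum_zero (x y : R) : columnSum x y 0 = -x ^ 3 := by
  simp [columnSum]

/-- Either the last crossing takes its upper face, with weight `x`, or it takes the right face and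
all others contribute `-y³`. -/
theorem columnSum_succ (x y : R) (n : ℕ) :
    columnSum x y (n + 1) = x * columnSum x y n + y * (-y ^ 3) ^ (n + 1) := by
  rw [columnSum, Fin.sum_univ_castSucc]
  congr 1
  · rw [columnSum, Finset.mul_sum]
    refine Finset.sum_congr rfl fun r _ => ?_
    rw [Fin.prod_univ_castSucc, mul_comm]
    congr 1
    · have h1 : ¬ Fin.last (n + 1) < r.castSucc := (Fin.castSucc_lt_last r).not_gt
      have h2 : Fin.last (n + 1) ≠ r.castSucc := (Fin.castSucc_lt_last r).ne'
      rw [if_neg h1, if_neg h2]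
    · simp
  · rw [Fin.prod_univ_castSucc, mul_comm]
    simp [Fin.castSucc_lt_last]

theorem mul_columnSum {x y : R} (h : x * y = 1) (n : ℕ) :
    (-x ^ 2 - y ^ 2) * columnSum x y n =
      (-y ^ 3) ^ (n + 1) + x ^ (n + 1) * ((-x ^ 2 - y ^ 2) ^ 2 - 1) := by
  induction n with
  | zero =>
    rw [columnSum_zero]
    linear_combination (-x * (x * y + 1) - y ^ 3) * h
  | succ n ih =>
    rw [columnSum_succ]
    linear_combination x * ih - x * (-y ^ 3) ^ (n + 1) * h

end Permutations

theorem columnSum_eq_columnBracket (ε : ℤˣ) (n : ℕ) :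
    columnSum (T (ε : ℤ)) (T (-(ε : ℤ))) n = columnBracket ε n := by
  refine mul_left_cancel₀ loopValue_ne_zero ?_
  rw [loopValue_mul_columnBracket, loopValue_eq ε, mul_columnSum]
  rw [← T_add]
  simp

/-! ### Perfect matchings as bijections. -/

section Matchings

variable {α β R : Type*} [Fintype α] [Fintype β] [CommRing R]

-- Perfect matchings are the graphs of bijections inside `E`; a bijection using a non-edge
-- contributes a zero factor.
open Classical in
theorem sum_perfectMatching_eq_sum_equiv (E : Finset (α × β)) (W : α → β → R)
    {p : Finset (α × β) → Prop} [DecidablePred p] (hp : ∀ P, p P ↔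
      P ⊆ E ∧ (∀ a, ∃! e, e ∈ P ∧ e.1 = a) ∧ ∀ b, ∃! e, e ∈ P ∧ e.2 = b) :
    ∑ P ∈ E.powerset.filter p, ∏ e ∈ P, W e.1 e.2 =
      ∑ f : α ≃ β, ∏ a, if (a, f a) ∈ E then W a (f a) else 0 := by
  have h : ∀ f : α ≃ β, (∏ a, if (a, f a) ∈ E then W a (f a) else 0) =
      if ∀ a, (a, f a) ∈ E then ∏ a, W a (f a) else 0 := by
    intro f
    split_ifs with hf
    · exact Finset.prod_congr rfl fun a _ => if_pos (hf a)
    · push Not at hf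
      obtain ⟨a, ha⟩ := hf
      exact Finset.prod_eq_zero (Finset.mem_univ a) (if_neg ha)
  rw [Finset.sum_congr rfl fun f _ => h f, ← Finset.sum_filter]
  symm
  refine Finset.sum_bij (fun f _ => Finset.univ.image fun a => (a, f a)) ?_ ?_ ?_ ?_
  · intro f hf
    have hf' : ∀ a, (a, f a) ∈ E := by simpa using hf
    have hsub : (Finset.univ.image fun a => (a, f a)) ⊆ E := by
      intro e he
      simp only [Finset.mem_image, Finset.mem_univ, true_and] at he
      obtain ⟨a, rfl⟩ := he
      exact hf' a
    refine Finset.mem_filter.2 ⟨Finset.mem_powerset.2 hsub,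
      (hp _).2 ⟨hsub, fun a => ?_, fun b => ?_⟩⟩
    · refine ⟨(a, f a), by simp, ?_⟩
      rintro ⟨a', b'⟩ ⟨h1, rfl⟩
      simpa [eq_comm] using h1
    · refine ⟨(f.symm b, b), by simp, ?_⟩
      rintro ⟨a', b'⟩ ⟨h1, rfl⟩
      have : f a' = b' := by simpa using h1
      simp [← this]
  · intro f _ g _ hfg
    ext a
    have : (a, f a) ∈ Finset.univ.image fun a => (a, g a) := hfg ▸ by simp
    simpa [eq_comm] using this
  · intro P hP
    obtain ⟨hPE, h1, h2⟩ := (hp P).1 (Finset.mem_filter.1 hP).2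
    have h1' : ∀ a, ∃ b, (a, b) ∈ P := by
      intro a
      obtain ⟨⟨a', b⟩, ⟨h, rfl⟩, -⟩ := h1 a
      exact ⟨b, h⟩
    choose f hf using h1'
    have huniq : ∀ {a b}, (a, b) ∈ P → b = f a := fun {a b} hab =>
      congrArg Prod.snd ((h1 a).unique ⟨hab, rfl⟩ ⟨hf a, rfl⟩)
    have hbij : Function.Bijective f := by
      constructor
      · intro a a' haa
        exact congrArg Prod.fst ((h2 (f a)).unique ⟨hf a, rfl⟩ ⟨hf a', haa.symm⟩)
      · intro b
        obtain ⟨⟨a, b'⟩, ⟨h, rfl⟩, -⟩ := h2 b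
        exact ⟨a, (huniq h).symm⟩
    refine ⟨Equiv.ofBijective f hbij, by simpa using fun a => hPE (hf a), ?_⟩
    ext ⟨a, b⟩
    simp only [Finset.mem_image, Finset.mem_univ, true_and, Equiv.ofBijective_apply,
      Prod.mk.injEq, exists_eq_left]
    exact ⟨fun h => h ▸ hf a, fun h => (huniq h).symm⟩
  · intro f _
    rw [Finset.prod_image]
    intro a _ a' _ h
    exact congrArg Prod.fst h

end Matchings

/-! ### Faces classified by column and position. -/

theorem face_eq_of_le {w : Word k} {j : Fin (k + 2)} {l l' : Level w} (hl : (l : ℕ) ≤ l')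
    (h : ∀ t : Crossing w, (l : ℕ) ≤ t → (t : ℕ) < l' → (crossingColumn w t : ℕ) + 1 ≠ j) :
    face w j l = face w j l' := by
  induction l' using Fin.induction with
  | zero => rw [show l = 0 from Fin.ext (by simpa using hl)]
  | succ t ih =>
    rcases hl.eq_or_lt with hl | hl
    · rw [Fin.ext hl]
    · rw [Fin.val_succ] at hl
      have h1 : j ≠ midColumn w t := by
        rintro rfl
        exact h t (by omega) (by simp) rfl
      refine (ih (by simpa using Nat.lt_succ_iff.1 hl) fun t' h1 h2 => h t' h1 ?_).trans
        (Quot.sound (.pass t j h1))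
      simp at h2 ⊢
      omega

theorem face_zero {w : Word k} (j : Fin (k + 2)) : face w j 0 = face w j (Fin.last _) :=
  Quot.sound (.close j)

namespace ColumnIndexing

variable {w : Word k} {ε : ℤˣ}

theorem start_add_extra_lt (c : ColumnIndexing w ε) (i : Fin k) :
    c.start i + c.extra i < w.length := by
  have := (c.index ⟨i, Fin.last _⟩).2
  rwa [c.index_val] at this

theorem crossingColumn_eq_iff (c : ColumnIndexing w ε) (t : Crossing w) (i : Fin k) :
    crossingColumn w t = i ↔ c.start i ≤ t ∧ (t : ℕ) ≤ c.start i + c.extra i := by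
  obtain ⟨⟨j, r⟩, rfl⟩ := c.index.surjective t
  rw [crossingColumn_index, c.index_val]
  constructor
  · rintro rfl
    omega
  · rintro ⟨h1, h2⟩
    rcases lt_trichotomy j i with h | h | h
    · have := c.start_lt h
      omega
    · exact h
    · have := c.start_lt h
      omega

/-- The position in its column of the face at a level: `0` for the face at the first and the last
level, and otherwise the position of the crossing below the face. -/
def facePosition (c : ColumnIndexing w ε) (j : Fin (k + 2)) (l : ℕ) : ℕ :=
  if h : 0 < (j : ℕ) ∧ (j : ℕ) - 1 < k then
    if l - c.start ⟨j - 1, h.2⟩ ≤ c.extra ⟨j - 1, h.2⟩ then l - c.start ⟨j - 1, h.2⟩ else 0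
  else 0

theorem facePosition_of_eq (c : ColumnIndexing w ε) {j : Fin (k + 2)} {i : Fin k}
    (h : (j : ℕ) = i + 1) (l : ℕ) :
    c.facePosition j l = if l - c.start i ≤ c.extra i then l - c.start i else 0 := by
  have hi : (⟨(j : ℕ) - 1, by omega⟩ : Fin k) = i := Fin.ext (by simp [h])
  rw [facePosition, dif_pos ⟨by omega, by omega⟩, hi]

theorem facePosition_of_ne (c : ColumnIndexing w ε) {j : Fin (k + 2)}
    (h : ∀ i : Fin k, (j : ℕ) ≠ i + 1) (l : ℕ) : c.facePosition j l = 0 := by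
  rw [facePosition, dif_neg]
  rintro ⟨h1, h2⟩
  exact h ⟨_, h2⟩ (by simp; omega)

theorem facePosition_zero (c : ColumnIndexing w ε) (j : Fin (k + 2)) :
    c.facePosition j 0 = 0 := by
  simp [facePosition]

/-- Truncated subtraction gives `0` at all levels above the crossings of the column, and the cutoff
gives `0` below its last crossing, as the closure requires. -/
theorem facePosition_step (c : ColumnIndexing w ε) {x y : Fin (k + 2) × Level w}
    (h : FaceStep w x y) : c.facePosition x.1 x.2 = c.facePosition y.1 y.2 := by
  cases h with
  | pass t j h =>
    by_cases hj : ∃ i : Fin k, (j : ℕ) = i + 1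
    · obtain ⟨i, hi⟩ := hj
      rw [c.facePosition_of_eq hi, c.facePosition_of_eq hi]
      have h1 : crossingColumn w t ≠ i := by
        rintro rfl
        exact h (Fin.ext hi)
      rw [Ne, c.crossingColumn_eq_iff] at h1
      simp only [Fin.val_castSucc, Fin.val_succ]
      split_ifs <;> omega
    · push Not at hj
      rw [c.facePosition_of_ne hj, c.facePosition_of_ne hj]
  | close j =>
    by_cases hj : ∃ i : Fin k, (j : ℕ) = i + 1
    · obtain ⟨i, hi⟩ := hj
      rw [c.facePosition_of_eq hi, c.facePosition_of_eq hi]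
      have := c.start_add_extra_lt i
      simp only [Fin.val_zero, Fin.val_last]
      rw [if_neg (by omega : ¬ w.length - c.start i ≤ c.extra i)]
      simp
    · push Not at hj
      rw [c.facePosition_of_ne hj, c.facePosition_of_ne hj]

/-- The position of a face in its column. -/
def position (c : ColumnIndexing w ε) : Face w → ℕ :=
  Quot.lift (fun x => c.facePosition x.1 x.2) fun _ _ h => c.facePosition_step h

theorem position_face (c : ColumnIndexing w ε) (j : Fin (k + 2)) (l : Level w) :
    c.position (face w j l) = c.facePosition j l := rfl

theorem column_face (j : Fin (k + 2)) (l : Level w) : (face w j l).column = j := rfl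

theorem face_cases (c : ColumnIndexing w ε) (j : Fin (k + 2)) (l : Level w) :
    face w j l = face w j 0 ∨ ∃ i : Fin k, ∃ q ≤ c.extra i,
      0 < q ∧ (j : ℕ) = i + 1 ∧ (l : ℕ) = c.start i + q := by
  by_cases hj : ∃ i : Fin k, (j : ℕ) = i + 1
  · obtain ⟨i, hi⟩ := hj
    have hcol : ∀ t, (crossingColumn w t : ℕ) + 1 = j →
        c.start i ≤ t ∧ (t : ℕ) ≤ c.start i + c.extra i := fun t ht =>
      (c.crossingColumn_eq_iff t i).1 (Fin.ext (by omega))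
    rcases le_or_gt (l : ℕ) (c.start i) with h | h
    · left
      refine (face_eq_of_le (Nat.zero_le _) fun t _ htl ht => ?_).symm
      have := hcol t ht
      omega
    rcases le_or_gt (l : ℕ) (c.start i + c.extra i) with h' | h'
    · exact .inr ⟨i, l - c.start i, by omega, by omega, hi, by omega⟩
    · left
      rw [face_zero]
      refine face_eq_of_le (Fin.le_last l) fun t hlt _ ht => ?_
      have := hcol t ht
      omega
  · push Not at hj
    exact .inl (face_eq_of_le (Nat.zero_le _) fun t _ _ ht => hj _ ht.symm).symm

theorem face_ext (c : ColumnIndexing w ε) {f g : Face w} (hcol : f.column = g.column)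
    (hpos : c.position f = c.position g) : f = g := by
  obtain ⟨⟨j, l⟩, rfl⟩ := Quot.exists_rep f
  obtain ⟨⟨j', l'⟩, rfl⟩ := Quot.exists_rep g
  obtain rfl : j = j' := hcol
  change c.position (face w j l) = c.position (face w j l') at hpos
  change face w j l = face w j l'
  have hinner : ∀ {l : Level w} {i q}, q ≤ c.extra i → (j : ℕ) = i + 1 →
      (l : ℕ) = c.start i + q → c.position (face w j l) = q := by
    intro l i q hq hj hl
    rw [position_face, c.facePosition_of_eq hj, hl, Nat.add_sub_cancel_left, if_pos hq]
  have hzero : c.position (face w j 0) = 0 := c.facePosition_zero j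
  rcases c.face_cases j l with h | ⟨i, q, hq, hq0, hj, hl⟩
  · rcases c.face_cases j l' with h' | ⟨i', q', hq', hq0', hj', hl'⟩
    · rw [h, h']
    · rw [h, hzero, hinner hq' hj' hl'] at hpos
      omega
  · rw [hinner hq hj hl] at hpos
    rcases c.face_cases j l' with h' | ⟨i', q', hq', hq0', hj', hl'⟩
    · rw [h', hzero] at hpos
      omega
    · rw [hinner hq' hj' hl'] at hpos
      obtain rfl : i = i' := Fin.ext (by omega)
      rw [show l = l' from Fin.ext (by omega)]

theorem face_ext_iff (c : ColumnIndexing w ε) {f g : Face w} :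
    f = g ↔ (f.column : ℕ) = g.column ∧ c.position f = c.position g :=
  ⟨fun h => h ▸ ⟨rfl, rfl⟩, fun h => c.face_ext (Fin.ext h.1) h.2⟩

variable (c : ColumnIndexing w ε) (j : Fin k) (r : Fin (c.extra j + 1))

theorem column_upperFace : ((upperFace w (c.index ⟨j, r⟩)).column : ℕ) = j + 1 := by
  rw [upperFace, column_face, midColumn, c.fst_get_index]
  rfl

theorem column_lowerFace : ((lowerFace w (c.index ⟨j, r⟩)).column : ℕ) = j + 1 := by
  rw [lowerFace, column_face, midColumn, c.fst_get_index]
  rfl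

theorem column_leftFace : ((leftFace w (c.index ⟨j, r⟩)).column : ℕ) = j := by
  rw [leftFace, column_face, leftColumn, c.fst_get_index]
  rfl

theorem column_rightFace : ((rightFace w (c.index ⟨j, r⟩)).column : ℕ) = j + 2 := by
  rw [rightFace, column_face, rightColumn, c.fst_get_index]
  rfl

theorem position_upperFace : c.position (upperFace w (c.index ⟨j, r⟩)) = r := by
  have h := c.column_upperFace j r
  rw [upperFace, column_face] at h
  rw [upperFace, position_face, c.facePosition_of_eq h,
    Fin.val_castSucc, c.index_val, Nat.add_sub_cancel_left, if_pos (by omega)]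

theorem position_lowerFace : c.position (lowerFace w (c.index ⟨j, r⟩)) =
    if (r : ℕ) + 1 ≤ c.extra j then (r : ℕ) + 1 else 0 := by
  have h := c.column_lowerFace j r
  rw [lowerFace, column_face] at h
  rw [lowerFace, position_face, c.facePosition_of_eq h,
    Fin.val_succ, c.index_val, add_assoc, Nat.add_sub_cancel_left]

/-- All crossings of the previous column lie higher up, so the face on the left is the one that
wraps around the closure. On the right, all crossings of the next column lie further down. -/
theorem position_leftFace : c.position (leftFace w (c.index ⟨j, r⟩)) = 0 := by
  rw [leftFace, position_face]
  have h := c.column_leftFace j r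
  rw [leftFace, column_face] at h
  by_cases hj : ∃ i : Fin k, (j : ℕ) = i + 1
  · obtain ⟨i, hi⟩ := hj
    have := c.start_lt (i := i) (j := j) (Fin.lt_def.2 (by omega))
    rw [c.facePosition_of_eq (h.trans hi), Fin.val_castSucc, c.index_val, if_neg (by omega)]
  · push Not at hj
    exact c.facePosition_of_ne (by rwa [h]) _

theorem position_rightFace : c.position (rightFace w (c.index ⟨j, r⟩)) = 0 := by
  rw [rightFace, position_face]
  have h := c.column_rightFace j r
  rw [rightFace, column_face] at h
  by_cases hj : ∃ i : Fin k, (j : ℕ) + 2 = i + 1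
  · obtain ⟨i, hi⟩ := hj
    have := c.start_lt (i := j) (j := i) (Fin.lt_def.2 (by omega))
    rw [c.facePosition_of_eq (h.trans hi), Fin.val_castSucc, c.index_val]
    split_ifs <;> omega
  · push Not at hj
    exact c.facePosition_of_ne (by rwa [h]) _

theorem touches_index_iff (f : Face w) : Touches w (c.index ⟨j, r⟩) f ↔
    ((f.column : ℕ) = j + 1 ∧ (c.position f = r ∨
      c.position f = if (r : ℕ) + 1 ≤ c.extra j then (r : ℕ) + 1 else 0)) ∨
    (((f.column : ℕ) = j ∨ (f.column : ℕ) = j + 2) ∧ c.position f = 0) := by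
  rw [Touches, c.face_ext_iff, c.face_ext_iff, c.face_ext_iff, c.face_ext_iff, column_upperFace,
    column_lowerFace, column_leftFace, column_rightFace, position_upperFace, position_lowerFace,
    position_leftFace, position_rightFace]
  tauto

end ColumnIndexing

/-! ### The Tait graph, its weights and the dimer model. -/

namespace ColumnIndexing

variable {w : Word k} {ε : ℤˣ}

/-- The balanced overlaid Tait graph with the crossings ordered from top to bottom, which omits
the outside face and the face next to it that meets the first level. -/
def tait (w : Word k) : BalancedOverlaidTait w where
  rank := Equiv.refl _
  omittedShaded := face w 1 0
  omittedUnshaded := face w 0 0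
  shaded := by simp [Face.Shaded, column_face]
  unshaded := by simp [Face.Shaded, column_face]
  touch := ⟨0, 0, .inr ⟨rfl, rfl⟩⟩

/-- The face matched with a crossing: in the first row the wrapping face of the next column, and
otherwise the face above the crossing. -/
def matchedFace (c : ColumnIndexing w ε) (x : Σ j, Fin (c.extra j + 1)) : Face w :=
  if x.2 = 0 then face w x.1.succ.succ 0 else upperFace w (c.index x)

theorem column_matchedFace (c : ColumnIndexing w ε) (j : Fin k) (q : Fin (c.extra j + 1)) :
    ((c.matchedFace ⟨j, q⟩).column : ℕ) = if (q : ℕ) = 0 then (j : ℕ) + 2 else j + 1 := by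
  rw [matchedFace]
  simp only [Fin.ext_iff, Fin.val_zero]
  split_ifs with h
  · simp [column_face]
  · rw [column_upperFace]

theorem position_matchedFace (c : ColumnIndexing w ε) (j : Fin k) (q : Fin (c.extra j + 1)) :
    c.position (c.matchedFace ⟨j, q⟩) = q := by
  rw [matchedFace]
  split_ifs with h
  · obtain rfl : q = 0 := h
    rw [position_face]
    exact c.facePosition_zero _
  · rw [position_upperFace]

theorem matchedFace_injective (c : ColumnIndexing w ε) : Function.Injective c.matchedFace := by
  rintro ⟨j, q⟩ ⟨j', q'⟩ h
  rw [c.face_ext_iff, column_matchedFace, column_matchedFace, position_matchedFace,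
    position_matchedFace] at h
  obtain ⟨h1, h2⟩ := h
  rw [h2] at h1
  obtain rfl : j = j' := by
    split_ifs at h1 <;> exact Fin.ext (by omega)
  obtain rfl : q = q' := Fin.ext h2
  rfl

theorem matchedFace_ne (c : ColumnIndexing w ε) (x : Σ j, Fin (c.extra j + 1)) :
    c.matchedFace x ≠ (tait w).omittedShaded ∧ c.matchedFace x ≠ (tait w).omittedUnshaded := by
  obtain ⟨j, q⟩ := x
  have h0 : c.position (tait w).omittedShaded = 0 := c.facePosition_zero _
  have h1 : ((tait w).omittedShaded.column : ℕ) = 1 := by simp [tait, column_face]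
  have h2 : ((tait w).omittedUnshaded.column : ℕ) = 0 := by simp [tait, column_face]
  rw [Ne, Ne, c.face_ext_iff, c.face_ext_iff, column_matchedFace, position_matchedFace, h0, h1, h2]
  constructor
  · rintro ⟨h3, h4⟩
    rw [if_pos h4] at h3
    omega
  · rintro ⟨h3, -⟩
    split_ifs at h3

theorem exists_matchedFace_eq (c : ColumnIndexing w ε) (f : Face w)
    (h1 : f ≠ (tait w).omittedShaded) (h2 : f ≠ (tait w).omittedUnshaded) :
    ∃ x, c.matchedFace x = f := by
  obtain ⟨⟨j, l⟩, rfl⟩ := Quot.exists_rep f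
  change ∃ x, c.matchedFace x = face w j l
  change face w j l ≠ face w 1 0 at h1
  change face w j l ≠ face w 0 0 at h2
  rcases c.face_cases j l with h | ⟨i, q, hq, hq0, hj, hl⟩
  · have hj0 : j ≠ 0 := by
      rintro rfl
      exact h2 h
    obtain ⟨j, rfl⟩ := Fin.exists_succ_eq.2 hj0
    have hj1 : j ≠ 0 := by
      rintro rfl
      exact h1 h
    obtain ⟨j, rfl⟩ := Fin.exists_succ_eq.2 hj1
    exact ⟨⟨j, 0⟩, by rw [h, matchedFace, if_pos rfl]⟩
  · refine ⟨⟨i, q, by omega⟩, ?_⟩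
    rw [c.face_ext_iff, column_matchedFace, position_matchedFace, column_face, position_face,
      c.facePosition_of_eq hj, hl, Nat.add_sub_cancel_left, if_pos hq, if_neg hq0.ne', hj]
    exact ⟨rfl, rfl⟩

/-- The remaining faces, indexed like the crossings. -/
def faceIndex (c : ColumnIndexing w ε) : (Σ j, Fin (c.extra j + 1)) ≃ (tait w).FaceVertex :=
  Equiv.ofBijective (fun x => ⟨c.matchedFace x, c.matchedFace_ne x⟩)
    ⟨fun _ _ h => c.matchedFace_injective (congrArg Subtype.val h), fun f => by
      obtain ⟨x, hx⟩ := c.exists_matchedFace_eq f.1 f.2.1 f.2.2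
      exact ⟨x, Subtype.ext hx⟩⟩

theorem faceIndex_val (c : ColumnIndexing w ε) (x) : (c.faceIndex x).1 = c.matchedFace x := rfl

/-- The left face of a crossing and the wrapping face of its own column, unless omitted, are indexed
by earlier blocks. -/
theorem blockSupport_of_touches (c : ColumnIndexing w ε) {x y : Σ j, Fin (c.extra j + 1)}
    (h : Touches w (c.index x) (c.matchedFace y)) : BlockSupport x y := by
  obtain ⟨j, r⟩ := x
  obtain ⟨j', q⟩ := y
  rw [touches_index_iff, column_matchedFace, position_matchedFace] at h
  simp only [BlockSupport, Fin.lt_def, Fin.ext_iff]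
  split_ifs at h <;> omega

theorem touches_matchedFace_iff (c : ColumnIndexing w ε) (j : Fin k)
    (r q : Fin (c.extra j + 1)) : Touches w (c.index ⟨j, r⟩) (c.matchedFace ⟨j, q⟩) ↔
      (q : ℕ) = 0 ∨ (q : ℕ) = r ∨ (q : ℕ) = r + 1 := by
  have := q.2
  rw [touches_index_iff, column_matchedFace, position_matchedFace]
  split_ifs <;> omega

/-- With the order from top to bottom, a face between two crossings has the upper one as its lowest
neighbour. For the face to the right of a column it is the first crossing of that column, since
later columns come later in the order. -/
theorem isLowest_faceIndex_iff (c : ColumnIndexing w ε) (j : Fin k) (r q : Fin (c.extra j + 1))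
    (h : Touches w (c.index ⟨j, r⟩) (c.matchedFace ⟨j, q⟩)) :
    (tait w).IsLowest (c.index ⟨j, r⟩) (c.faceIndex ⟨j, q⟩) ↔
      ((q : ℕ) = 0 ∧ r = 0) ∨ (q : ℕ) = r + 1 := by
  rw [BalancedOverlaidTait.IsLowest, faceIndex_val, and_iff_right h]
  have hle : ∀ t t', (tait w).rank t ≤ (tait w).rank t' ↔ (t : ℕ) ≤ t' := fun _ _ => Iff.rfl
  simp only [hle]
  rw [touches_matchedFace_iff] at h
  constructor
  · intro hmin
    rcases h with h | h | h
    · have := hmin (c.index ⟨j, 0⟩) ((c.touches_matchedFace_iff j 0 q).2 (.inl h))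
      rw [c.index_val, c.index_val] at this
      exact .inl ⟨h, Fin.ext (by simpa using this)⟩
    · by_cases h0 : (q : ℕ) = 0
      · exact .inl ⟨h0, Fin.ext (by rw [Fin.val_zero]; omega)⟩
      · have := hmin (c.index ⟨j, ⟨r - 1, by omega⟩⟩)
          ((c.touches_matchedFace_iff j _ q).2 (.inr (.inr (by simp; omega))))
        rw [c.index_val, c.index_val] at this
        simp only at this
        omega
    · exact .inr h
  · intro hq t' ht'
    obtain ⟨⟨j', r'⟩, rfl⟩ := c.index.surjective t'
    have hs := c.blockSupport_of_touches ht'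
    rw [c.index_val, c.index_val]
    rcases hs with hs | ⟨hj, hs⟩
    · have : c.start j + c.extra j < c.start j' := c.start_lt hs
      omega
    · obtain rfl : j = j' := hj
      dsimp only at hs
      rcases hq with ⟨-, rfl⟩ | hq
      · simp
      · omega

theorem checkerboardPositive_index_iff (c : ColumnIndexing w ε) (j : Fin k)
    (r : Fin (c.extra j + 1)) : CheckerboardPositive w (c.index ⟨j, r⟩) ↔
      if ε = 1 then ¬ Odd (j : ℕ) else Odd (j : ℕ) := by
  rw [CheckerboardPositive, c.sign_eq]
  split_ifs
  · rw [Face.Shaded, column_upperFace, Nat.odd_add_one]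
  · rw [Face.Shaded, column_leftFace]

-- Shading and checkerboard sign both alternate with the column, so only `ε` and the parity of the
-- face relative to the crossing matter.
open Classical in
theorem specialize_letter (w : Word k) (ε : ℤˣ) (t : Crossing w) (f : (tait w).FaceVertex)
    {j : ℕ} (ht : CheckerboardPositive w t ↔ if ε = 1 then ¬ Odd j else Odd j) :
    (tait w).weight t f = if (f.1.Shaded ↔ Odd j) then
      (if (tait w).IsLowest t f then -T (ε : ℤ) ^ 3 else T (-(ε : ℤ)))
    else (if (tait w).IsLowest t f then -T (-(ε : ℤ)) ^ 3 else T (ε : ℤ)) := by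
  rw [BalancedOverlaidTait.weight, BalancedOverlaidTait.letter]
  rcases Int.units_eq_one_or ε with rfl | rfl <;>
    by_cases hj : Odd j <;> by_cases hf : f.1.Shaded <;>
    by_cases hl : (tait w).IsLowest t f <;>
    simp [ht, hj, hf, hl, ActivityLetter.specialize, T_pow]

theorem weight_faceIndex (c : ColumnIndexing w ε) (j : Fin k) (r q : Fin (c.extra j + 1))
    (h : Touches w (c.index ⟨j, r⟩) (c.matchedFace ⟨j, q⟩)) :
    (tait w).weight (c.index ⟨j, r⟩) (c.faceIndex ⟨j, q⟩) =
      if (q : ℕ) = 0 then (if r = 0 then -T (ε : ℤ) ^ 3 else T (-(ε : ℤ)))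
      else if (q : ℕ) = r then T (ε : ℤ) else -T (-(ε : ℤ)) ^ 3 := by
  rw [specialize_letter w ε _ _ (c.checkerboardPositive_index_iff j r), Face.Shaded,
    faceIndex_val, column_matchedFace]
  simp only [c.isLowest_faceIndex_iff j r q h]
  rw [touches_matchedFace_iff] at h
  by_cases hq : (q : ℕ) = 0
  · have h1 : Odd ((j : ℕ) + 2) ↔ Odd (j : ℕ) := by
      rw [Nat.odd_add, iff_true_right even_two]
    simp only [if_pos hq, h1, if_true]
    refine if_congr ?_ rfl rfl
    omega
  · have h1 : ¬ (Odd ((j : ℕ) + 1) ↔ Odd (j : ℕ)) := by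
      rw [Nat.odd_add_one]
      tauto
    rw [if_neg hq, if_neg hq, if_neg h1]
    by_cases hr : (q : ℕ) = r
    · rw [if_pos hr, if_neg (by omega)]
    · rw [if_neg hr, if_pos (by omega)]

open Classical in
/-- The weights of the edges, indexed by the columns and the positions in them. -/
def edgeWeight (c : ColumnIndexing w ε) (x y : Σ j, Fin (c.extra j + 1)) : LaurentPolynomial ℤ :=
  if Touches w (c.index x) (c.matchedFace y) then
    (tait w).weight (c.index x) (c.faceIndex y) else 0

theorem edgeWeight_eq_zero (c : ColumnIndexing w ε) (x y) (h : ¬ BlockSupport x y) :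
    c.edgeWeight x y = 0 := if_neg fun h' => h (c.blockSupport_of_touches h')

theorem partitionFunction_tait (c : ColumnIndexing w ε) :
    (tait w).partitionFunction =
      ∑ σ : Equiv.Perm (Σ j, Fin (c.extra j + 1)), ∏ x, c.edgeWeight x (σ x) := by
  classical
  have h : ∀ σ : Equiv.Perm (Σ j, Fin (c.extra j + 1)),
      ∏ x, c.edgeWeight x (σ x) = ∏ t : Crossing w,
        if (t, Equiv.equivCongr c.index c.faceIndex σ t) ∈ (tait w).edges then
          (tait w).weight t (Equiv.equivCongr c.index c.faceIndex σ t) else 0 := by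
    intro σ
    rw [← Equiv.prod_comp c.index (fun t : Crossing w =>
      if (t, Equiv.equivCongr c.index c.faceIndex σ t) ∈ (tait w).edges then
          (tait w).weight t (Equiv.equivCongr c.index c.faceIndex σ t) else 0)]
    refine Finset.prod_congr rfl fun x _ => ?_
    simp only [edgeWeight, BalancedOverlaidTait.edges, Finset.mem_filter, Finset.mem_univ,
      true_and, Equiv.equivCongr_apply_apply, Equiv.symm_apply_apply, faceIndex_val]
  rw [Finset.sum_congr rfl fun σ _ => h σ]
  rw [Equiv.sum_comp (Equiv.equivCongr c.index c.faceIndex)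
    fun f : Crossing w ≃ (tait w).FaceVertex => ∏ t : Crossing w,
      if (t, f t) ∈ (tait w).edges then (tait w).weight t (f t) else 0]
  rw [BalancedOverlaidTait.partitionFunction]
  convert sum_perfectMatching_eq_sum_equiv (tait w).edges (tait w).weight
    (p := (tait w).IsPerfectMatching) fun _ => Iff.rfl

theorem isDimerModel_tait (c : ColumnIndexing w ε) : (tait w).IsDimerModel := by
  rw [BalancedOverlaidTait.IsDimerModel, c.partitionFunction_tait,
    sum_perm_prod_eq_prod c.edgeWeight_eq_zero, c.bracket_eq]
  refine Finset.prod_congr rfl fun j _ => ?_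
  rw [← columnSum_eq_columnBracket]
  refine Finset.sum_congr rfl fun r _ => Finset.prod_congr rfl fun q _ => ?_
  have ht : Touches w (c.index ⟨j, q⟩) (c.matchedFace ⟨j, Fin.cycleRange r q⟩) := by
    rw [touches_matchedFace_iff]
    rcases lt_trichotomy q r with h | rfl | h
    · rw [Fin.coe_cycleRange_of_lt h]
      omega
    · simp
    · rw [Fin.cycleRange_of_gt h]
      omega
  rw [edgeWeight, if_pos ht, c.weight_faceIndex j q _ ht]
  rcases lt_trichotomy q r with h | rfl | h
  · rw [Fin.coe_cycleRange_of_lt h, if_pos h, if_neg (by omega), if_neg (by omega)]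
  · simp
  · have h' := h
    rw [Fin.lt_def] at h'
    rw [Fin.cycleRange_of_gt h, if_neg h.not_gt, if_neg h.ne', if_neg (by omega), if_pos rfl]

/-! ### The determinant with Kauffman's signs. -/

theorem kauffmanSignedMatrix_eq_zero (c : ColumnIndexing w ε) (x y) (h : ¬ BlockSupport x y) :
    (tait w).kauffmanSignedMatrix.submatrix c.index c.faceIndex x y = 0 :=
  if_neg fun h' => h (c.blockSupport_of_touches h')

/-- The upper face of the first crossing of a column is omitted or belongs to the previous block, so
within a diagonal block the sign affects only diagonal entries outside the first column. -/
theorem kauffmanSignedMatrix_eq (c : ColumnIndexing w ε) (x y : Σ j, Fin (c.extra j + 1))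
    (h : y.1 = x.1) : (tait w).kauffmanSignedMatrix.submatrix c.index c.faceIndex x y =
      blockSign x y * c.edgeWeight x y := by
  classical
  obtain ⟨j, r⟩ := x
  obtain ⟨j', q⟩ := y
  obtain rfl : j' = j := h
  have hup : c.matchedFace ⟨j', q⟩ = upperFace w (c.index ⟨j', r⟩) ↔
      (⟨j', q⟩ : Σ j, Fin (c.extra j + 1)) = ⟨j', r⟩ ∧ (q : ℕ) ≠ 0 := by
    rw [c.face_ext_iff, column_matchedFace, position_matchedFace, column_upperFace,
      position_upperFace]
    simp only [Sigma.mk.injEq, heq_eq_eq, true_and, Fin.ext_iff]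
    split_ifs <;> omega
  simp only [Matrix.submatrix_apply, BalancedOverlaidTait.kauffmanSignedMatrix, Matrix.of_apply,
    faceIndex_val, edgeWeight, blockSign, hup]
  split_ifs <;> simp

theorem exists_bracket_eq_smul_det (c : ColumnIndexing w ε)
    (e : Crossing w ≃ (tait w).FaceVertex) : ∃ u : ℤˣ,
      bracket w = u • ((tait w).kauffmanSignedMatrix.submatrix id e).det := by
  classical
  obtain ⟨u, hu⟩ := exists_sum_perm_eq_smul_det c.edgeWeight_eq_zero
    c.kauffmanSignedMatrix_eq_zero c.kauffmanSignedMatrix_eq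
  rw [← c.partitionFunction_tait, c.isDimerModel_tait] at hu
  -- Any two identifications of rows with columns differ by a permutation, which multiplies the
  -- determinant by its sign.
  let ρ : Equiv.Perm (Crossing w) := (c.index.symm.trans c.faceIndex).trans e.symm
  have hM : (tait w).kauffmanSignedMatrix.submatrix c.index c.faceIndex =
      (((tait w).kauffmanSignedMatrix.submatrix id e).submatrix id ρ).submatrix
        c.index c.index := by
    ext x y
    simp [ρ]
  rw [hM, Matrix.det_submatrix_equiv_self, Matrix.det_permute'] at hu
  refine ⟨u * Equiv.Perm.sign ρ, ?_⟩
  rw [hu, mul_smul, Units.smul_def (Equiv.Perm.sign ρ), zsmul_eq_mul]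

end ColumnIndexing

end ClosedBraid

end

theorem mainTheorem1 (k : ℕ) (m : Fin k → ℤ) (hm : (∀ i, 0 < m i) ∨ (∀ i, m i < 0)) :
    ∃ G : ClosedBraid.BalancedOverlaidTait (ClosedBraid.powerWord m),
      G.IsDimerModel ∧
      Nonempty (ClosedBraid.Crossing (ClosedBraid.powerWord m) ≃ G.FaceVertex) ∧
      ∀ e : ClosedBraid.Crossing (ClosedBraid.powerWord m) ≃ G.FaceVertex, ∃ u : ℤˣ,
        ClosedBraid.jones (ClosedBraid.powerWord m) =
          u • (ClosedBraid.writheFactor (ClosedBraid.powerWord m) *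
            (G.kauffmanSignedMatrix.submatrix id e).det) := by
  obtain ⟨ε, ⟨c⟩⟩ := ClosedBraid.exists_columnIndexing hm
  refine ⟨ClosedBraid.ColumnIndexing.tait _, c.isDimerModel_tait,
    ⟨c.index.symm.trans c.faceIndex⟩, fun e => ?_⟩
  obtain ⟨u, hu⟩ := c.exists_bracket_eq_smul_det e
  exact ⟨u, by rw [ClosedBraid.jones, hu, mul_smul_comm]⟩
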